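/- **Setting.** Let $\tau,b,t,m$ be integers with $\tau>b\ge 1$, $t\ge 4\tau$, $m\ge 1$, and let $\mathbb F$ be a finite field that has a $2m\tau\times 2m\tau$ Cauchy matrix $A$, i.e. $A_{r,c}=1/(x_r-y_c)$ where $x_0,\dots,x_{2m\tau-1},y_0,\dots,y_{2m\tau-1}\in\mathbb F$ are pairwise distinct; fix such an $A$. Let $k_0,\dots,k_t\in\{0,\dots,m\}$ be message packet sizes with $k_i=0$ for $i<2\tau$ and for $i>t-2\tau$ (zero padding). *Streaming codes.* In time slot $i\in\{0,\dots,t\}$ a message packet $S[i]\in\mathbb F^{k_i}$ arrives and a channel packet $X[i]\in\mathbb F^{n_i}$ is sent. An (offline) streaming code consists of sizes $n_i\ge 0$ and arbitrary encoding maps giving $X[i]$ as a function of $S[0],\dots,S[i]$, all of which may depend on the whole sequence $k_0,\dots,k_t$. Each channel packet is either received or lost. An admissible loss pattern is a set of lost slots such that for every $i\in\{0,\dots,t-\tau-b+1\}$, if $X[i]$ is lost then $X[i+b],\dots,X[i+b+\tau-1]$ are received. *Lossless-delay constraint* ($\tau_L=1$): when nothing is lost, each $S[i]$ can be decoded from the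 packets of slots $0,\dots,\min(i+1,t)$. *Worst-case-delay constraint*: for each $i$ there is a decoder that, under every admissible loss pattern, recovers $S[i]$ from what is received in slots $0,\dots,\min(i+\tau,t)$. The *rate* is $\sum_{i=0}^t k_i\big/\sum_{i=0}^t n_i$ (read as $0$ if all $n_i=0$). A code is *rate optimal* if it meets both constraints and no code over $\mathbb F$ for $k_0,\dots,k_t$ that meets both has a higher rate. *Integer program.* Over integers $f^{(IP)}_i,p^{(IP)}_i$ ($0\le i\le t$) minimise $\sum_{i=0}^t p^{(IP)}_i$ subject to $0\le f^{(IP)}_i\le k_i$, $p^{(IP)}_i\ge 0$ for all $i$, and, for all $i\in\{3\tau,\dots,t-\tau\}$ and $j\in\{i-\tau-b+1,\dots,i-\tau+1\}$, $$-f^{(IP)}_{j-1}-\mathbf 1[j+b-1=i-\tau]\,\bigl(k_{i-\tau}-f^{(IP)}_{i-\tau}\bigr)+\sum_{l=j-1}^{i-\tau}k_l\ \le\ \sum_{l=j+b}^{i}p^{(IP)}_l .$$ Its output is $\langle f_i\rangle_{0\le i\le t}$ with $f_i=f^{(IP)}_i$ for some minimiser. *Spread Code.* The $(\tau,b,t,\langle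 f_i\rangle)$-Spread Code is defined as follows. Put $p_i=0$ for $i<3\tau$ and $i>t-\tau$, and $f'_i=0$ for $i<2\tau$ and $i>t-2\tau$. For $i=2\tau,\dots,t-2\tau$ in turn let $f'_i=\max(f_i,p_{i+\tau})$, where $p_{i+\tau}$ is $$\max_{j\in\{i-b+1,\dots,i+1\}}\Bigl(0,\ \mathbf 1[j+b-1\ge i+1](k_i-f_i)+\mathbf 1[j\le i]f_i+\sum_{l=j}^{i}(k_{l-1}-f'_{l-1})+\sum_{l=j}^{i-1}f'_l-\sum_{l=j+b}^{i+\tau-1}p_l\Bigr).$$ Write $S_a^c[i]$ for the symbols of $S[i]$ in positions $a,\dots,c$ (counted from $0$). Then $X[i]=(U[i],V[i],P[i])$ with $$U[i]=S_0^{p_{i+\tau}-1}[i],\qquad V[i]=\bigl(S_{p_{i+\tau}}^{f'_i-1}[i],\,S_{f'_{i-1}}^{k_{i-1}-1}[i-1]\bigr),\qquad P[i]=U[i-\tau]+W[i]A_{(i)}.$$ Here $P[i]$ has length $p_i$; $X[i]$ is empty for $i<2\tau$; $W[i]\in\mathbb F^{2m\tau}$ holds, for each $j\in\{i-\tau,\dots,i-1\}$,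 the vector $V[j]$ padded with zeros to length $2m$ in positions $2m(j\bmod\tau),\dots,2m(j\bmod\tau)+2m-1$; and $A_{(i)}$ consists of the columns $2m(i\bmod\tau),\dots,2m(i\bmod\tau)+p_i-1$ of $A$. **Theorem.** If $\langle f_i\rangle$ is an output of the integer program for $(\tau,b,t,k_0,\dots,k_t)$, then the $(\tau,b,t,\langle f_i\rangle)$-Spread Code is rate optimal. -/

import Mathlib

namespace Streaming

/-- A sequence of message packets of sizes `k 0, k 1, …`: the packet `S[i]` is the vector
`s i` of `k i` symbols of `F`. Only the time slots `0, …, t` are ever used below. -/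
abbrev Messages (F : Type*) (k : ℕ → ℕ) := ∀ i : ℕ, Fin (k i) → F

/-- An offline encoder for the (known) message size sequence `k`: in time slot `i` it sends the
channel packet `enc i s`, which consists of `size i` symbols and depends only on the message
packets of time slots `0, …, i`. The sizes `size i` and the maps `enc i` may depend on all of `k`,
and the maps are arbitrary (not necessarily linear or systematic). -/
structure StreamingCode (F : Type*) (k : ℕ → ℕ) where
  size : ℕ → ℕ
  enc : ∀ i : ℕ, Messages F k → (Fin (size i) → F)
  causal : ∀ (i : ℕ) (s s' : Messages F k), (∀ j ≤ i, s j = s' j) → enc i s = enc i s'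

/-- What the receiver has seen after time slot `min T t` when the packets of the time slots in `L`
are lost: the channel packet `some X[l]` if `l ∉ L`, and `none` (the symbol `*`) if `l ∈ L`. -/
noncomputable def received {F : Type*} {k : ℕ → ℕ} (C : StreamingCode F k) (t T : ℕ) (L : Set ℕ)
    (s : Messages F k) (l : Fin (min T t + 1)) : Option (Fin (C.size l) → F) :=
  open Classical in if (l : ℕ) ∈ L then none else some (C.enc l s)

/-- The message packet of time slot `i` can be decoded by time slot `T` (or by the end `t` of the
transmission, if that is earlier): one decoder works for all loss patterns in `𝓛` and for all
message packets. -/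
def DecodableBy {F : Type*} {k : ℕ → ℕ} (C : StreamingCode F k) (t : ℕ) (𝓛 : Set (Set ℕ))
    (i T : ℕ) : Prop :=
  ∃ dec : (∀ l : Fin (min T t + 1), Option (Fin (C.size l) → F)) → (Fin (k i) → F),
    ∀ L ∈ 𝓛, ∀ s : Messages F k, dec (received C t T L s) = s i

/-- The loss patterns of the channel: for every `i ∈ {0, …, t - τ - b + 1}`, if `X[i]` is lost then
`X[i+b], …, X[i+b+τ-1]` are received. -/
def admissibleLosses (τ b t : ℕ) : Set (Set ℕ) :=
  {L | ∀ i ∈ L, i + τ + b ≤ t + 1 → ∀ j ∈ Set.Ico (i + b) (i + b + τ), j ∉ L}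

/-- Without losses, each `S[i]` is decoded by time slot `i + τL`. -/
def LosslessDelay {F : Type*} {k : ℕ → ℕ} (C : StreamingCode F k) (t τL : ℕ) : Prop :=
  ∀ i ≤ t, DecodableBy C t {∅} i (i + τL)

/-- Under every admissible loss pattern, each `S[i]` is decoded by time slot `i + τ`. -/
def WorstCaseDelay {F : Type*} {k : ℕ → ℕ} (C : StreamingCode F k) (τ b t : ℕ) : Prop :=
  ∀ i ≤ t, DecodableBy C t (admissibleLosses τ b t) i (i + τ)

/-- The rate `(∑_{i ≤ t} k_i) / (∑_{i ≤ t} n_i)`. -/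
noncomputable def rate {F : Type*} {k : ℕ → ℕ} (C : StreamingCode F k) (t : ℕ) : ℝ :=
  (∑ i ∈ Finset.range (t + 1), (k i : ℝ)) / ∑ i ∈ Finset.range (t + 1), (C.size i : ℝ)

/-- `C` meets both delay constraints, and no code that meets them has a higher rate. -/
def IsRateOptimal {F : Type*} {k : ℕ → ℕ} (C : StreamingCode F k) (τL τ b t : ℕ) : Prop :=
  (LosslessDelay C t τL ∧ WorstCaseDelay C τ b t) ∧
    ∀ C' : StreamingCode F k, LosslessDelay C' t τL → WorstCaseDelay C' τ b t →
      rate C' t ≤ rate C t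

/-! ### The integer program -/

/-- `(f, p)` satisfies the constraints of the integer program. -/
def IPFeasible (τ b t : ℕ) (k f p : ℕ → ℕ) : Prop :=
  (∀ i ≤ t, f i ≤ k i) ∧
  ∀ i ∈ Finset.Icc (3 * τ) (t - τ), ∀ j ∈ Finset.Icc (i - τ - b + 1) (i - τ + 1),
    -(f (j - 1) : ℤ) - (if j + b - 1 = i - τ then (k (i - τ) : ℤ) - f (i - τ) else 0)
        + ∑ l ∈ Finset.Icc (j - 1) (i - τ), (k l : ℤ)
      ≤ ∑ l ∈ Finset.Icc (j + b) i, (p l : ℤ)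

/-- `f` is a possible output of the algorithm: together with some `p` it is a feasible pair
that minimises the total number of parity symbols. -/
def IsIPOutput (τ b t : ℕ) (k f : ℕ → ℕ) : Prop :=
  ∃ p : ℕ → ℕ, IPFeasible τ b t k f p ∧
    ∀ g q : ℕ → ℕ, IPFeasible τ b t k g q →
      ∑ i ∈ Finset.range (t + 1), p i ≤ ∑ i ∈ Finset.range (t + 1), q i

/-! ### The Spread Code -/

/-- `f'_i = max (f_i, p_{i+τ})`, and `f'_i = 0` in the first and in the last `2τ` slots. -/
def spreadPolicy (τ t : ℕ) (f p : ℕ → ℕ) (i : ℕ) : ℕ :=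
  if i < 2 * τ ∨ t < i + 2 * τ then 0 else max (f i) (p (i + τ))

/-- The number of parity symbols of time slot `n`, in terms of the numbers `p l` for `l < n`. For
`n = i + τ` with `2τ ≤ i ≤ t - 2τ` it is the maximum of `0` and, over `j ∈ {i-b+1, …, i+1}`, of
`1[j+b-1 ≥ i+1] (k_i - f_i) + 1[j ≤ i] f_i + ∑_{l=j}^{i} (k_{l-1} - f'_{l-1}) + ∑_{l=j}^{i-1} f'_l
  - ∑_{l=j+b}^{i+τ-1} p_l`. -/
def parityStep (τ b t : ℕ) (k f p : ℕ → ℕ) (n : ℕ) : ℕ :=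
  if 3 * τ ≤ n ∧ n + τ ≤ t then
    let i := n - τ
    (Finset.Icc (i + 1 - b) (i + 1)).sup fun j =>
      ((if i + 1 ≤ j + b - 1 then (k i : ℤ) - f i else 0)
        + (if j ≤ i then (f i : ℤ) else 0)
        + ∑ l ∈ Finset.Icc j i, ((k (l - 1) : ℤ) - spreadPolicy τ t f p (l - 1))
        + ∑ l ∈ Finset.Ico j i, (spreadPolicy τ t f p l : ℤ)
        - ∑ l ∈ Finset.Ico (j + b) (i + τ), (p l : ℤ)).toNat
  else 0

/-- The number `p_n` of parity symbols that the Spread Code sends in time slot `n`. -/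
def parity (τ b t : ℕ) (k f : ℕ → ℕ) (n : ℕ) : ℕ :=
  parityStep τ b t k f (fun l => if _h : l < n then parity τ b t k f l else 0) n
termination_by n

/-- The recursive definition of `parity` unfolds to the intended equation. -/
theorem parity_eq (τ b t : ℕ) (k f : ℕ → ℕ) (hb : 0 < b) (hτ : b < τ) (n : ℕ) :
    parity τ b t k f n = parityStep τ b t k f (parity τ b t k f) n := by
  rw [parity]
  unfold parityStep
  split_ifs with hn
  swap
  · rfl
  refine Finset.sup_congr rfl fun j hj => ?_
  rw [Finset.mem_Icc] at hj
  have hsp : ∀ l, l + τ < n →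
      spreadPolicy τ t f (fun l => if _h : l < n then parity τ b t k f l else 0) l
        = spreadPolicy τ t f (parity τ b t k f) l := by
    intro l hl
    simp [spreadPolicy, hl]
  have h1 : ∑ l ∈ Finset.Icc j (n - τ), ((k (l - 1) : ℤ) - spreadPolicy τ t f
        (fun l => if _h : l < n then parity τ b t k f l else 0) (l - 1))
      = ∑ l ∈ Finset.Icc j (n - τ), ((k (l - 1) : ℤ) -
        spreadPolicy τ t f (parity τ b t k f) (l - 1)) := by
    refine Finset.sum_congr rfl fun l hl => ?_
    rw [Finset.mem_Icc] at hl
    rw [hsp (l - 1) (by omega)]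
  have h2 : ∑ l ∈ Finset.Ico j (n - τ), (spreadPolicy τ t f
        (fun l => if _h : l < n then parity τ b t k f l else 0) l : ℤ)
      = ∑ l ∈ Finset.Ico j (n - τ), (spreadPolicy τ t f (parity τ b t k f) l : ℤ) := by
    refine Finset.sum_congr rfl fun l hl => ?_
    rw [Finset.mem_Ico] at hl
    rw [hsp l (by omega)]
  have h3 : ∑ l ∈ Finset.Ico (j + b) (n - τ + τ),
        ((if _h : l < n then parity τ b t k f l else 0 : ℕ) : ℤ)
      = ∑ l ∈ Finset.Ico (j + b) (n - τ + τ), (parity τ b t k f l : ℤ) := by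
    refine Finset.sum_congr rfl fun l hl => ?_
    rw [Finset.mem_Ico] at hl
    rw [dif_pos (by omega)]
  simp only [h1, h2, h3]

/-- `A` is a Cauchy matrix: `A r c = 1 / (x_r - y_c)` for pairwise distinct elements
`x_0, x_1, …, y_0, y_1, …` of the field. -/
def IsCauchyMatrix {F : Type*} [Field F] {N : ℕ} (A : Matrix (Fin N) (Fin N) F) : Prop :=
  ∃ x y : Fin N → F, Function.Injective x ∧ Function.Injective y ∧ (∀ r c, x r ≠ y c) ∧
    ∀ r c, A r c = 1 / (x r - y c)

/-- The symbol `S_r[i]` (and `0` if there is no such symbol). -/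
def sym {F : Type*} [Field F] {k : ℕ → ℕ} (s : Messages F k) (i r : ℕ) : F :=
  if h : r < k i then s i ⟨r, h⟩ else 0

section SpreadCode

variable {F : Type*} [Field F] (τ b t m : ℕ) (k f : ℕ → ℕ)

/-- The policy `f'_i` that the Spread Code really uses: `S[i]` is split into its first `f'_i`
symbols, sent in `X[i]`, and its other symbols, sent in `X[i+1]`. -/
def usedPolicy (i : ℕ) : ℕ := spreadPolicy τ t f (parity τ b t k f) i

/-- `U[i]` is the first `u_i = p_{i+τ}` symbols of `S[i]`. -/
def partU (s : Messages F k) (i : ℕ) : Fin (parity τ b t k f (i + τ)) → F := fun r => sym s i r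

/-- The length `v_i` of `V[i]`. For `i = 0` the second summand is `k_0 - f'_0`, which is `0` since
`k_0 = 0`. -/
def lenV (i : ℕ) : ℕ :=
  (usedPolicy τ b t k f i - parity τ b t k f (i + τ))
    + (k (i - 1) - usedPolicy τ b t k f (i - 1))

/-- `V[i]` is the other symbols of `S[i]` that are sent in `X[i]`, namely those in positions
`p_{i+τ}, …, f'_i - 1`, followed by the symbols of `S[i-1]` in positions
`f'_{i-1}, …, k_{i-1} - 1`. -/
def partV (s : Messages F k) (i : ℕ) : Fin (lenV τ b t k f i) → F :=
  Fin.append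
    (fun r : Fin (usedPolicy τ b t k f i - parity τ b t k f (i + τ)) =>
      sym s i (parity τ b t k f (i + τ) + r))
    (fun r : Fin (k (i - 1) - usedPolicy τ b t k f (i - 1)) =>
      sym s (i - 1) (usedPolicy τ b t k f (i - 1) + r))

/-- The vector `W[i]` of length `2mτ`: for `j ∈ {i-τ, …, i-1}` its positions
`2m (j mod τ), …, 2m (j mod τ) + 2m - 1` hold `V[j]` followed by zeros. -/
def vecW (s : Messages F k) (i : ℕ) : Fin (2 * m * τ) → F := fun r =>
  ∑ j ∈ Finset.Ico (i - τ) i,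
    if j % τ = (r : ℕ) / (2 * m) then
      (if h : (r : ℕ) % (2 * m) < lenV τ b t k f j then
        partV τ b t k f s j ⟨(r : ℕ) % (2 * m), h⟩ else 0)
    else 0

/-- `P^{(v)}[i]`, the product of `W[i]` with the columns
`2m (i mod τ), …, 2m (i mod τ) + p_i - 1` of `A`. (These columns exist, since `p_i ≤ 2m`.) -/
def partPv (A : Matrix (Fin (2 * m * τ)) (Fin (2 * m * τ)) F) (s : Messages F k) (i : ℕ) :
    Fin (parity τ b t k f i) → F := fun c =>
  if h : 2 * m * (i % τ) + c < 2 * m * τ then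
    Matrix.vecMul (vecW τ b t m k f s i) A ⟨2 * m * (i % τ) + c, h⟩
  else 0

/-- `P[i] = U[i-τ] + P^{(v)}[i]`. It is empty for `i < 3τ`, and `U[i-τ]` consists of the first
`p_i` symbols of `S[i-τ]`. -/
def partP (A : Matrix (Fin (2 * m * τ)) (Fin (2 * m * τ)) F) (s : Messages F k) (i : ℕ) :
    Fin (parity τ b t k f i) → F := fun c =>
  sym s (i - τ) c + partPv τ b t m k f A s i c

/-- The Spread Code for the policies `f`: `X[i] = (U[i], V[i], P[i])`. -/
def spreadCode (A : Matrix (Fin (2 * m * τ)) (Fin (2 * m * τ)) F) : StreamingCode F k where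
  size i := parity τ b t k f (i + τ) + lenV τ b t k f i + parity τ b t k f i
  enc i s := Fin.append (Fin.append (partU τ b t k f s i) (partV τ b t k f s i))
    (partP τ b t m k f A s i)
  causal i s s' h := by
    have hsym : ∀ j ≤ i, ∀ r, sym s j r = sym s' j r := by
      intro j hj r
      simp only [sym, h j hj]
    have hV : ∀ j ≤ i, partV τ b t k f s j = partV τ b t k f s' j := by
      intro j hj
      unfold partV
      congr 1
      · funext r
        exact hsym j hj _
      · funext r
        exact hsym (j - 1) (by omega) _
    have hU : partU τ b t k f s i = partU τ b t k f s' i := by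
      funext r
      exact hsym i le_rfl _
    have hW : vecW τ b t m k f s i = vecW τ b t m k f s' i := by
      funext r
      refine Finset.sum_congr rfl fun j hj => ?_
      rw [hV j (Finset.mem_Ico.1 hj).2.le]
    have hP : partP τ b t m k f A s i = partP τ b t m k f A s' i := by
      funext c
      simp only [partP, partPv, hW, hsym (i - τ) (by omega)]
    rw [hU, hV i le_rfl, hP]

end SpreadCode

end Streaming

/-! Every code meeting both constraints yields a feasible point of the integer program whose parity
total is the redundancy of the code. The Spread Code for an optimal `f` needs no more parity than
the optimum, so no code is shorter.

Converse: for uniform messages let e_i be the entropy, in symbols, of the message packets before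
slot i together with X[i], rounded up. With K_i message symbols before slot i, put f_i = e_i - K_i
and p_i = n_i - (e_i - e_{i-1}), where e_{-1} = 0. Lossless delay one gives p_i ≥ 0. A burst in
slots a+1, …, a+b gives the constraints of the program: counting received symbols suffices when it
ends at slot i (`knownCount_burst_eq`), and submodularity is needed when it ends later
(`knownCount_burst_lt`). Entropies of nonlinear codes may be fractional, but each inequality has at
most one of them on its smaller side, so rounding up preserves it.

Achievability: the greedy parity counts have partial sums below those of any feasible p for the same
`f` (`messageCount_parity_le`), yet satisfy all burst constraints for the enlarged policy f'
(`parity_invariants`). Hence the parity received after a burst, up to slot a+τ, is at least as long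
as the lost V (`sum_lenV_le`), and the Cauchy matrix makes the equations uniquely solvable
(`partV_eq_of_burst`). Then P[i+τ] reveals U[i]. -/

namespace Streaming

open Finset

/-! ### Entropy of partitions of a finite uniform space -/

section Entropy

variable {Ω : Type*} [Fintype Ω]

open Classical in
/-- The size of the class of `ω` under the equivalence relation `r`. -/
noncomputable def classCard (r : Setoid Ω) (ω : Ω) : ℕ :=
  (univ.filter fun ω' => r ω ω').card

/-- The Shannon entropy, to the base `q`, of the partition of `Ω` into the classes of `r`, for a
uniformly distributed element of `Ω`. -/
noncomputable def entropy (q : ℕ) (r : Setoid Ω) : ℝ :=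
  Real.logb q (Fintype.card Ω) - (∑ ω, Real.logb q (classCard r ω)) / Fintype.card Ω

theorem classCard_pos (r : Setoid Ω) (ω : Ω) : 0 < classCard r ω := by
  classical
  exact card_pos.2 ⟨ω, by simp⟩

theorem classCard_congr (r : Setoid Ω) {ω ω' : Ω} (h : r ω ω') :
    classCard r ω = classCard r ω' := by
  classical
  unfold classCard
  congr 1
  ext x
  simp only [mem_filter, mem_univ, true_and]
  exact ⟨fun hx => r.trans (r.symm h) hx, fun hx => r.trans h hx⟩

theorem classCard_mono {r s : Setoid Ω} (h : r ≤ s) (ω : Ω) : classCard r ω ≤ classCard s ω := by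
  classical
  refine card_le_card fun x hx => ?_
  simp only [mem_filter, mem_univ, true_and] at hx ⊢
  exact h hx

/-- Pairwise equivalent points lie in one class, so every summand is at most `1 / T.card`. Both main
entropy inequalities come down to this count. -/
theorem sum_inv_classCard_le_one (r : Setoid Ω) (T : Finset Ω)
    (hT : ∀ ω ∈ T, ∀ ω' ∈ T, r ω ω') : ∑ ω ∈ T, (1 : ℝ) / classCard r ω ≤ 1 := by
  classical
  rcases T.eq_empty_or_nonempty with rfl | hne
  · simp
  have hpos : (0 : ℝ) < T.card := by exact_mod_cast hne.card_pos
  calc ∑ ω ∈ T, (1 : ℝ) / classCard r ω ≤ ∑ ω ∈ T, (1 : ℝ) / T.card := by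
        refine sum_le_sum fun ω hω => one_div_le_one_div_of_le hpos ?_
        have : T.card ≤ classCard r ω := by
          refine card_le_card fun x hx => ?_
          simpa using hT ω hω x hx
        exact_mod_cast this
    _ = 1 := by
        rw [sum_const, nsmul_eq_mul]
        field_simp

/-- Jensen's inequality for the logarithm, by log x ≤ x - 1. -/
theorem sum_logb_nonpos {q : ℕ} (hq : 1 < q) (c : Ω → ℝ) (hc : ∀ ω, 0 < c ω)
    (h : ∑ ω, c ω ≤ Fintype.card Ω) : ∑ ω, Real.logb q (c ω) ≤ 0 := by
  have hlog : 0 < Real.log q := Real.log_pos (by exact_mod_cast hq)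
  simp only [Real.logb, ← sum_div]
  refine div_nonpos_of_nonpos_of_nonneg ?_ hlog.le
  calc ∑ ω, Real.log (c ω) ≤ ∑ ω, (c ω - 1) :=
        sum_le_sum fun ω _ => Real.log_le_sub_one_of_pos (hc ω)
    _ ≤ 0 := by
        rw [sum_sub_distrib]
        simpa using h

/-- Finer partitions are smaller setoids, so `r ≤ s` reads "r determines s" and `⊓` is joint
observation; entropy reverses the order. -/
theorem entropy_mono {q : ℕ} (hq : 1 < q) {r s : Setoid Ω} (h : r ≤ s) :
    entropy q s ≤ entropy q r := by
  unfold entropy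
  gcongr with ω
  · exact_mod_cast hq
  · exact_mod_cast classCard_pos r ω
  · exact_mod_cast classCard_mono h ω

theorem entropy_top [Nonempty Ω] (q : ℕ) : entropy q (⊤ : Setoid Ω) = 0 := by
  have h : ∀ ω : Ω, classCard ⊤ ω = Fintype.card Ω := by
    intro ω
    simp [classCard, Finset.card_univ, Setoid.top_def]
  unfold entropy
  simp only [h, sum_const, nsmul_eq_mul, card_univ]
  have : (Fintype.card Ω : ℝ) ≠ 0 := by exact_mod_cast Fintype.card_ne_zero
  field_simp
  ring

theorem entropy_bot (q : ℕ) : entropy q (⊥ : Setoid Ω) = Real.logb q (Fintype.card Ω) := by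
  have h : ∀ ω : Ω, classCard ⊥ ω = 1 := by
    intro ω
    rw [classCard, card_eq_one]
    refine ⟨ω, ?_⟩
    ext x
    simp [Setoid.bot_def, eq_comm]
  simp [entropy, h]

/-- Observing one more variable with values in `β` adds at most `log |β|` to the entropy. -/
theorem entropy_inf_ker_le {β : Type*} [Fintype β] [Nonempty β] [Nonempty Ω] {q : ℕ} (hq : 1 < q)
    (r : Setoid Ω) (Y : Ω → β) :
    entropy q (r ⊓ Setoid.ker Y) ≤ entropy q r + Real.logb q (Fintype.card β) := by
  classical
  set s := r ⊓ Setoid.ker Y with hs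
  have hN : (0 : ℝ) < Fintype.card Ω := by exact_mod_cast Fintype.card_pos
  have hβ : (0 : ℝ) < Fintype.card β := by exact_mod_cast Fintype.card_pos
  have hr : ∀ ω, (0 : ℝ) < classCard r ω := fun ω => by exact_mod_cast classCard_pos r ω
  have hsp : ∀ ω, (0 : ℝ) < classCard s ω := fun ω => by exact_mod_cast classCard_pos s ω
  -- A class of `r` splits into at most one class of `s` per value of `Y`, so the ratio averages to
  -- at most `|β|`.
  have key : ∑ ω, (classCard r ω : ℝ) / classCard s ω ≤ Fintype.card β * Fintype.card Ω := by
    calc ∑ ω, (classCard r ω : ℝ) / classCard s ω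
        = ∑ ω, ∑ ω', if r ω ω' then (1 : ℝ) / classCard s ω else 0 := by
          refine sum_congr rfl fun ω _ => ?_
          rw [← sum_filter, sum_const, nsmul_eq_mul, classCard, mul_one_div]
      _ = ∑ ω', ∑ ω, if r ω ω' then (1 : ℝ) / classCard s ω else 0 := sum_comm
      _ = ∑ ω', ∑ b, ∑ ω ∈ univ.filter (fun ω => r ω ω' ∧ Y ω = b),
            (1 : ℝ) / classCard s ω := by
          refine sum_congr rfl fun ω' _ => ?_
          rw [← sum_filter, ← sum_fiberwise (univ.filter fun ω => r ω ω') Y]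
          simp only [filter_filter]
      _ ≤ ∑ _ω' : Ω, ∑ _b : β, (1 : ℝ) := by
          refine sum_le_sum fun ω' _ => sum_le_sum fun b _ => ?_
          refine sum_inv_classCard_le_one s _ fun x hx y hy => ?_
          simp only [mem_filter, mem_univ, true_and] at hx hy
          exact ⟨r.trans hx.1 (r.symm hy.1), hx.2.trans hy.2.symm⟩
      _ = Fintype.card β * Fintype.card Ω := by simp [mul_comm]
  have h := sum_logb_nonpos hq (fun ω => (classCard r ω : ℝ) / classCard s ω / Fintype.card β)
    (fun ω => by have := hr ω; have := hsp ω; positivity) (by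
      rw [← sum_div, div_le_iff₀ hβ]
      linarith [key])
  have h2 : ∀ ω, Real.logb q ((classCard r ω : ℝ) / classCard s ω / Fintype.card β)
      = Real.logb q (classCard r ω) - Real.logb q (classCard s ω)
        - Real.logb q (Fintype.card β) := by
    intro ω
    rw [Real.logb_div (div_pos (hr ω) (hsp ω)).ne' hβ.ne', Real.logb_div (hr ω).ne' (hsp ω).ne']
  simp only [h2, sum_sub_distrib, sum_const, card_univ, nsmul_eq_mul] at h
  unfold entropy
  have h3 : (∑ ω, Real.logb q (classCard r ω)) / Fintype.card Ω
      ≤ (∑ ω, Real.logb q (classCard s ω)) / Fintype.card Ω + Real.logb q (Fintype.card β) := by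
    rw [div_add' _ _ _ hN.ne', div_le_div_iff_of_pos_right hN]
    linarith
  linarith

/-- Conditioning on a finer partition reduces the conditional entropy. -/
theorem entropy_submodular [Nonempty Ω] {q : ℕ} (hq : 1 < q) {y z : Setoid Ω} (hyz : y ≤ z)
    (x : Setoid Ω) :
    entropy q (y ⊓ x) + entropy q z ≤ entropy q (z ⊓ x) + entropy q y := by
  classical
  have hN : (0 : ℝ) < Fintype.card Ω := by exact_mod_cast Fintype.card_pos
  have hp : ∀ (r : Setoid Ω) ω, (0 : ℝ) < classCard r ω :=
    fun r ω => by exact_mod_cast classCard_pos r ω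
  -- The logarithm of this ratio averages to H(x|y) - H(x|z). Writing the factor `classCard y ω` as
  -- a sum over `ω'` and exchanging the sums leaves at most 1 for each `ω'`.
  have key : ∑ ω, (classCard (z ⊓ x) ω : ℝ) * classCard y ω
      / (classCard z ω * classCard (y ⊓ x) ω) ≤ Fintype.card Ω := by
    calc ∑ ω, (classCard (z ⊓ x) ω : ℝ) * classCard y ω
          / (classCard z ω * classCard (y ⊓ x) ω)
        = ∑ ω, ∑ ω', if y ω ω' then
            (classCard (z ⊓ x) ω : ℝ) / (classCard z ω * classCard (y ⊓ x) ω) else 0 := by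
          refine sum_congr rfl fun ω _ => ?_
          rw [← sum_filter, sum_const, nsmul_eq_mul]
          change _ = (classCard y ω : ℝ) * _
          ring
      _ = ∑ ω', ∑ ω, if y ω ω' then
            (classCard (z ⊓ x) ω : ℝ) / (classCard z ω * classCard (y ⊓ x) ω) else 0 := sum_comm
      _ ≤ ∑ _ω' : Ω, (1 : ℝ) := by
          refine sum_le_sum fun ω' _ => ?_
          -- As `y ≤ z`, points related by `y` share their `z`-class: the factor for `z` depends on
          -- `ω'` only, and `classCard (z ⊓ x) ω` becomes a sum over the `z`-class of `ω'`.
          have e1 : ∀ ω, (if y ω ω' then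
              (classCard (z ⊓ x) ω : ℝ) / (classCard z ω * classCard (y ⊓ x) ω) else 0)
              = (1 / classCard z ω') * ∑ ω'', if z ω' ω'' then
                (if y ω ω' ∧ x ω ω'' then (1 : ℝ) / classCard (y ⊓ x) ω else 0) else 0 := by
            intro ω
            split_ifs with hy
            · have hz : z ω ω' := hyz hy
              have e2 : ∀ ω'', (if z ω' ω'' then
                  (if y ω ω' ∧ x ω ω'' then (1 : ℝ) / classCard (y ⊓ x) ω else 0) else 0)
                  = if (z ⊓ x) ω ω'' then (1 : ℝ) / classCard (y ⊓ x) ω else 0 := by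
                intro ω''
                have : (z ⊓ x) ω ω'' ↔ z ω' ω'' ∧ x ω ω'' := by
                  constructor
                  · rintro ⟨h1, h2⟩
                    exact ⟨z.trans (z.symm hz) h1, h2⟩
                  · rintro ⟨h1, h2⟩
                    exact ⟨z.trans hz h1, h2⟩
                simp only [this, hy, true_and, ite_and]
              simp only [e2]
              rw [← sum_filter, sum_const, nsmul_eq_mul, classCard_congr z hz]
              change _ = _ * ((classCard (z ⊓ x) ω : ℝ) * _)
              have h1 := (hp z ω').ne'
              have h2 := (hp (y ⊓ x) ω).ne'
              field_simp
            · simp [hy]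
          simp only [e1]
          rw [← mul_sum, sum_comm]
          have e3 : ∑ ω'', ∑ ω, (if z ω' ω'' then
                (if y ω ω' ∧ x ω ω'' then (1 : ℝ) / classCard (y ⊓ x) ω else 0) else 0)
              ≤ classCard z ω' := by
            calc _ ≤ ∑ ω'', if z ω' ω'' then (1 : ℝ) else 0 := by
                  refine sum_le_sum fun ω'' _ => ?_
                  split_ifs with hz
                  · rw [← sum_filter]
                    refine sum_inv_classCard_le_one _ _ fun u hu v hv => ?_
                    simp only [mem_filter, mem_univ, true_and] at hu hv
                    exact ⟨y.trans hu.1 (y.symm hv.1), x.trans hu.2 (x.symm hv.2)⟩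
                  · simp
              _ = classCard z ω' := by simp [classCard]
          rw [one_div, inv_mul_le_iff₀ (hp z ω'), mul_one]
          exact e3
      _ = Fintype.card Ω := by simp
  have h := sum_logb_nonpos hq _ (fun ω => by
    have := hp z ω; have := hp y ω; have := hp (z ⊓ x) ω; have := hp (y ⊓ x) ω; positivity) key
  have h2 : ∀ ω, Real.logb q ((classCard (z ⊓ x) ω : ℝ) * classCard y ω
      / (classCard z ω * classCard (y ⊓ x) ω))
      = Real.logb q (classCard (z ⊓ x) ω) + Real.logb q (classCard y ω)
        - (Real.logb q (classCard z ω) + Real.logb q (classCard (y ⊓ x) ω)) := by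
    intro ω
    have h1 := (hp z ω).ne'
    have h2 := (hp (y ⊓ x) ω).ne'
    have h3 := (hp y ω).ne'
    have h4 := (hp (z ⊓ x) ω).ne'
    rw [Real.logb_div (mul_ne_zero h4 h3) (mul_ne_zero h1 h2), Real.logb_mul h4 h3,
      Real.logb_mul h1 h2]
  simp only [h2, sum_sub_distrib, sum_add_distrib] at h
  unfold entropy
  have h3 : (∑ ω, Real.logb q (classCard (z ⊓ x) ω)) / Fintype.card Ω
      + (∑ ω, Real.logb q (classCard y ω)) / Fintype.card Ω
      ≤ (∑ ω, Real.logb q (classCard z ω)) / Fintype.card Ω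
        + (∑ ω, Real.logb q (classCard (y ⊓ x) ω)) / Fintype.card Ω := by
    rw [← add_div, ← add_div, div_le_div_iff_of_pos_right hN]
    linarith
  linarith

end Entropy

/-! ### Loss patterns, and decodability as injectivity -/

theorem not_mem_admissible {τ b t : ℕ} {L : Set ℕ} (hL : L ∈ admissibleLosses τ b t) {i n : ℕ}
    (hi : i ∈ L) (hit : i + τ + b ≤ t + 1) (h1 : i + b ≤ n) (h2 : n < i + b + τ) : n ∉ L :=
  hL i hi hit n ⟨h1, h2⟩

theorem burst_mem_admissibleLosses (τ b t j : ℕ) :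
    Set.Ico j (j + b) ∈ admissibleLosses τ b t := by
  intro i hi _ n hn hn'
  simp only [Set.mem_Ico] at hi hn hn'
  omega

theorem DecodableBy.eq_of_forall {F : Type*} {k : ℕ → ℕ} {C : StreamingCode F k} {t i T : ℕ}
    {𝓛 : Set (Set ℕ)} (h : DecodableBy C t 𝓛 i T) {L : Set ℕ} (hL : L ∈ 𝓛) {s s' : Messages F k}
    (hs : ∀ l ≤ min T t, l ∉ L → C.enc l s = C.enc l s') : s i = s' i := by
  obtain ⟨dec, hdec⟩ := h
  rw [← hdec L hL s, ← hdec L hL s']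
  congr 1
  funext l
  unfold received
  split_ifs with hl
  · rfl
  · rw [hs l (by omega) hl]

/-- The received word shows which visible slots were lost, so one decoder serves all patterns: it
picks any message sequence and pattern consistent with what it sees. The default `x` is used only on
words that never occur. -/
theorem decodableBy_of_forall {F : Type*} [Nonempty F] {k : ℕ → ℕ} {C : StreamingCode F k}
    {t i T : ℕ} {𝓛 : Set (Set ℕ)}
    (h : ∀ L ∈ 𝓛, ∀ s s' : Messages F k, (∀ l ≤ min T t, l ∉ L → C.enc l s = C.enc l s') →
      s i = s' i) : DecodableBy C t 𝓛 i T := by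
  classical
  obtain ⟨x⟩ := ‹Nonempty F›
  refine ⟨fun r => if hr : ∃ s, ∃ L ∈ 𝓛, received C t T L s = r then hr.choose i else fun _ => x,
    fun L hL s => ?_⟩
  have hr : ∃ s', ∃ L' ∈ 𝓛, received C t T L' s' = received C t T L s := ⟨s, L, hL, rfl⟩
  beta_reduce
  rw [dif_pos hr]
  obtain ⟨L', hL', he⟩ := hr.choose_spec
  refine h L' hL' _ _ fun l hl hlL => ?_
  have := congrFun he ⟨l, by omega⟩
  simp only [received, if_neg hlL] at this
  split_ifs at this with h2
  exact Option.some.inj this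

/-! ### What the packets of an arbitrary code determine -/

section Converse

variable {F : Type*} {k : ℕ → ℕ}

/-- The number of message symbols of the time slots before `i`. -/
def messageCount (k : ℕ → ℕ) (i : ℕ) : ℕ := ∑ l ∈ range i, k l

theorem messageCount_succ (k : ℕ → ℕ) (i : ℕ) :
    messageCount k (i + 1) = messageCount k i + k i := sum_range_succ _ _

/-- The message packets of the time slots `0, …, t`. -/
abbrev FiniteMessages (F : Type*) (k : ℕ → ℕ) (t : ℕ) := ∀ i : Fin (t + 1), Fin (k i) → F

/-- Continue a finite sequence of message packets by packets of zeros. -/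
def extendMessages [Zero F] (t : ℕ) (ω : FiniteMessages F k t) : Messages F k := fun i =>
  if h : i < t + 1 then ω ⟨i, h⟩ else 0

/-- Two message sequences agree before time slot `i`. -/
def prefixSetoid [Zero F] (k : ℕ → ℕ) (t i : ℕ) : Setoid (FiniteMessages F k t) where
  r ω ω' := ∀ l < i, extendMessages t ω l = extendMessages t ω' l
  iseqv := ⟨fun _ _ _ => rfl, fun h l hl => (h l hl).symm,
    fun h h' l hl => (h l hl).trans (h' l hl)⟩

/-- Two message sequences lead to the same channel packet in time slot `i`. -/
def packetSetoid [Zero F] (C : StreamingCode F k) (t i : ℕ) : Setoid (FiniteMessages F k t) :=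
  Setoid.ker fun ω => C.enc i (extendMessages t ω)

/-- Two message sequences lead to the same channel packets in the time slots `a + 1, …, c`. -/
def packetsSetoid [Zero F] (C : StreamingCode F k) (t a c : ℕ) :
    Setoid (FiniteMessages F k t) where
  r ω ω' := ∀ l, a < l → l ≤ c → C.enc l (extendMessages t ω) = C.enc l (extendMessages t ω')
  iseqv := ⟨fun _ _ _ _ => rfl, fun h l hl hl' => (h l hl hl').symm,
    fun h h' l hl hl' => (h l hl hl').trans (h' l hl hl')⟩

/-- Two message sequences agree before time slot `i` and lead to the same channel packet in time
slot `i`. -/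
def prefixPacketSetoid [Zero F] (C : StreamingCode F k) (t i : ℕ) :
    Setoid (FiniteMessages F k t) :=
  prefixSetoid k t i ⊓ packetSetoid C t i

theorem prefixSetoid_anti [Zero F] (t : ℕ) {i j : ℕ} (h : i ≤ j) :
    prefixSetoid (F := F) k t j ≤ prefixSetoid k t i :=
  fun _ _ hω l hl => hω l (hl.trans_le h)

theorem enc_eq_of_prefix [Zero F] (C : StreamingCode F k) {t i l : ℕ}
    {ω ω' : FiniteMessages F k t} (h : prefixSetoid k t i ω ω') (hl : l < i) :
    C.enc l (extendMessages t ω) = C.enc l (extendMessages t ω') :=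
  C.causal l _ _ fun j hj => h j (hj.trans_lt hl)

theorem prefixSetoid_succ_le [Zero F] (C : StreamingCode F k) (t i : ℕ) :
    prefixSetoid k t (i + 1) ≤ prefixPacketSetoid C t i :=
  fun _ _ h => ⟨prefixSetoid_anti t (Nat.le_succ i) h, enc_eq_of_prefix C h (Nat.lt_succ_self i)⟩

/-- Here lossless delay enters: S[i] is due by slot `i + 1`, and the packets before slot `i` are
functions of the prefix. -/
theorem prefixPacketSetoid_succ [Zero F] (C : StreamingCode F k) {t i : ℕ}
    (hC : LosslessDelay C t 1) (hi : i + 1 ≤ t) :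
    prefixPacketSetoid C t i ⊓ packetSetoid C t (i + 1) ≤ prefixPacketSetoid C t (i + 1) := by
  rintro ω ω' ⟨⟨h1, h2⟩, h3⟩
  refine ⟨fun l hl => ?_, h3⟩
  rcases Nat.lt_succ_iff_lt_or_eq.1 hl with hl | rfl
  · exact h1 l hl
  refine (hC l (by omega)).eq_of_forall (Set.mem_singleton _) fun n hn _ => ?_
  rcases lt_trichotomy n l with hnl | rfl | hnl
  · exact enc_eq_of_prefix C h1 hnl
  · exact h2
  · obtain rfl : n = l + 1 := by omega
    exact h3

theorem prefixPacketSetoid_packets [Zero F] (C : StreamingCode F k) {t a c : ℕ}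
    (hC : LosslessDelay C t 1) (hac : a ≤ c) (hc : c ≤ t) :
    prefixPacketSetoid C t a ⊓ packetsSetoid C t a c ≤ prefixPacketSetoid C t c := by
  induction c, hac using Nat.le_induction with
  | base => exact inf_le_left
  | succ c hac ih =>
    rintro ω ω' ⟨h1, h2⟩
    refine prefixPacketSetoid_succ C hC hc ⟨ih (by omega) ⟨h1, fun l hl hl' => h2 l hl ?_⟩, ?_⟩
    · omega
    · exact h2 (c + 1) (by omega) le_rfl

/-- Lose exactly the slots `a + 1, …, a + b`. All other packets up to slot `i + τ` are known, which
meets the deadline of every message packet up to `i`. -/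
theorem prefixPacketSetoid_burst [Zero F] (C : StreamingCode F k) {τ b t a i : ℕ}
    (hC : WorstCaseDelay C τ b t) (hai : a ≤ i) (hiab : i ≤ a + b) (hit : i + τ ≤ t) :
    prefixPacketSetoid C t a ⊓ packetsSetoid C t (a + b) (i + τ) ≤ prefixSetoid k t (i + 1) := by
  rintro ω ω' ⟨⟨h1, h2⟩, h3⟩ l hl
  rcases lt_or_ge l a with hla | hla
  · exact h1 l hla
  refine (hC l (by omega)).eq_of_forall (burst_mem_admissibleLosses τ b t (a + 1))
    fun n hn hn' => ?_
  simp only [Set.mem_Ico, not_and_or, not_le, not_lt] at hn'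
  rcases lt_trichotomy n a with hna | rfl | hna
  · exact enc_eq_of_prefix C h1 hna
  · exact h2
  · exact h3 n (by omega) (by omega)

section Entropy

variable [Fintype F] [Field F]

theorem entropy_inf_packetSetoid_le (C : StreamingCode F k) (t i : ℕ)
    (r : Setoid (FiniteMessages F k t)) :
    entropy (Fintype.card F) (r ⊓ packetSetoid C t i) ≤ entropy (Fintype.card F) r + C.size i := by
  have hq : 1 < Fintype.card F := Fintype.one_lt_card
  refine (entropy_inf_ker_le hq r _).trans_eq ?_
  have hq' : (1 : ℝ) < Fintype.card F := by exact_mod_cast hq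
  rw [Fintype.card_fun, Fintype.card_fin, Nat.cast_pow, Real.logb_pow, Real.logb_self_eq_one hq',
    mul_one]

theorem entropy_inf_packetsSetoid_le (C : StreamingCode F k) (t : ℕ) {a c : ℕ} (hac : a ≤ c)
    (r : Setoid (FiniteMessages F k t)) :
    entropy (Fintype.card F) (r ⊓ packetsSetoid C t a c)
      ≤ entropy (Fintype.card F) r + ∑ l ∈ Ioc a c, (C.size l : ℝ) := by
  have hq : 1 < Fintype.card F := Fintype.one_lt_card
  induction c, hac using Nat.le_induction with
  | base =>
    rw [Ioc_self, sum_empty, add_zero]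
    refine entropy_mono hq ?_
    exact le_inf le_rfl fun ω ω' _ l hl hl' => by omega
  | succ c hac ih =>
    have h : r ⊓ packetsSetoid C t a c ⊓ packetSetoid C t (c + 1)
        ≤ r ⊓ packetsSetoid C t a (c + 1) := by
      rintro ω ω' ⟨⟨h1, h2⟩, h3⟩
      refine ⟨h1, fun l hl hl' => ?_⟩
      rcases hl'.lt_or_eq with hl' | rfl
      · exact h2 l hl (by omega)
      · exact h3
    rw [sum_Ioc_succ_top hac]
    have := entropy_mono hq h
    have := entropy_inf_packetSetoid_le C t (c + 1) (r ⊓ packetsSetoid C t a c)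
    linarith

theorem entropy_prefixSetoid_succ_le (t i : ℕ) :
    entropy (Fintype.card F) (prefixSetoid (F := F) k t (i + 1))
      ≤ entropy (Fintype.card F) (prefixSetoid (F := F) k t i) + k i := by
  have hq : 1 < Fintype.card F := Fintype.one_lt_card
  have h : prefixSetoid (F := F) k t i ⊓ Setoid.ker (fun ω => extendMessages t ω i)
      ≤ prefixSetoid k t (i + 1) := by
    rintro ω ω' ⟨h1, h2⟩ l hl
    rcases Nat.lt_succ_iff_lt_or_eq.1 hl with hl | rfl
    · exact h1 l hl
    · exact h2
  refine (entropy_mono hq h).trans ((entropy_inf_ker_le hq _ _).trans_eq ?_)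
  have hq' : (1 : ℝ) < Fintype.card F := by exact_mod_cast hq
  rw [Fintype.card_fun, Fintype.card_fin, Nat.cast_pow, Real.logb_pow, Real.logb_self_eq_one hq',
    mul_one]

/-- Slot `i` adds at most `k i`, and at `t + 1` the entropy is the full logarithm of the number of
message sequences. Induction upwards from 0 gives `≤`, downwards from `t + 1` gives `≥`. -/
theorem entropy_prefixSetoid (t : ℕ) {i : ℕ} (hi : i ≤ t + 1) :
    entropy (Fintype.card F) (prefixSetoid (F := F) k t i) = messageCount k i := by
  have hq : 1 < Fintype.card F := Fintype.one_lt_card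
  have hq' : (1 : ℝ) < Fintype.card F := by exact_mod_cast hq
  refine le_antisymm ?_ ?_
  · clear hi
    induction i with
    | zero =>
      have : prefixSetoid (F := F) k t 0 = ⊤ := by
        refine top_le_iff.1 fun ω ω' _ l hl => by omega
      rw [this, entropy_top]
      positivity
    | succ i ih =>
      rw [messageCount_succ]
      push_cast
      linarith [entropy_prefixSetoid_succ_le (F := F) (k := k) t i]
  · induction hi using Nat.decreasingInduction with
    | self =>
      have : prefixSetoid (F := F) k t (t + 1) = ⊥ := by
        refine le_bot_iff.1 fun ω ω' h => ?_
        change ω = ω'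
        funext i
        have := h i i.2
        simpa only [extendMessages, dif_pos i.2] using this
      rw [this, entropy_bot, Fintype.card_pi]
      simp only [Fintype.card_fun, Fintype.card_fin]
      rw [prod_pow_eq_pow_sum, Nat.cast_pow, Real.logb_pow, Real.logb_self_eq_one hq', mul_one,
        Fin.sum_univ_eq_sum_range (fun i => k i)]
      rfl
    | of_succ i hi ih =>
      rw [messageCount_succ] at ih
      push_cast at ih
      linarith [entropy_prefixSetoid_succ_le (F := F) (k := k) t i]

end Entropy

end Converse

/-! ### From a code to a feasible point of the integer program -/

theorem sum_Icc_messageCount (k : ℕ → ℕ) {a i : ℕ} (h : a ≤ i + 1) :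
    ∑ l ∈ Icc a i, (k l : ℤ) = messageCount k (i + 1) - messageCount k a := by
  rw [← Ico_add_one_right_eq_Icc, sum_Ico_eq_sub _ h]
  simp [messageCount]

theorem ceil_le_ceil_add_natCast {x y : ℝ} {n : ℕ} (h : x ≤ y + n) : ⌈x⌉ ≤ ⌈y⌉ + n := by
  rw [← Int.ceil_add_natCast]
  exact Int.ceil_le_ceil h

section Converse

variable {F : Type*} {k : ℕ → ℕ} [Field F] [Fintype F]

/-- The number of message symbols that are known after time slot `i` has been received by someone
who knows the message packets of the time slots before `i`, rounded up to an integer. -/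
noncomputable def knownCount (C : StreamingCode F k) (t i : ℕ) : ℤ :=
  ⌈entropy (Fintype.card F) (prefixPacketSetoid C t i)⌉

variable (C : StreamingCode F k) {τ b t : ℕ}

/-- This and the next bound confine the policy `knownCount C t i - messageCount k i` to the range
from 0 to `k i`. -/
theorem messageCount_le_knownCount {i : ℕ} (hi : i ≤ t) :
    (messageCount k i : ℤ) ≤ knownCount C t i := by
  have h := entropy_mono (Fintype.one_lt_card (α := F)) (inf_le_left :
    prefixPacketSetoid C t i ≤ prefixSetoid k t i)
  rw [entropy_prefixSetoid t (by omega)] at h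
  exact_mod_cast h.trans (Int.le_ceil _)

theorem knownCount_le_messageCount {i : ℕ} (hi : i ≤ t) :
    knownCount C t i ≤ messageCount k (i + 1) := by
  have h := entropy_mono (Fintype.one_lt_card (α := F)) (prefixSetoid_succ_le C t i)
  rw [entropy_prefixSetoid t (by omega)] at h
  exact Int.ceil_le.2 (by exact_mod_cast h)

theorem knownCount_zero_le : knownCount C t 0 ≤ C.size 0 := by
  have h := entropy_inf_packetSetoid_le C t 0 (prefixSetoid k t 0)
  rw [entropy_prefixSetoid t (by omega)] at h
  refine Int.ceil_le.2 (h.trans_eq ?_)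
  simp [messageCount]

/-- Makes the parity counts extracted from the code nonnegative. -/
theorem knownCount_succ_le (hC : LosslessDelay C t 1) {i : ℕ} (hi : i + 1 ≤ t) :
    knownCount C t (i + 1) ≤ knownCount C t i + C.size (i + 1) :=
  ceil_le_ceil_add_natCast <|
    (entropy_mono (Fintype.one_lt_card (α := F)) (prefixPacketSetoid_succ C hC hi)).trans
      (entropy_inf_packetSetoid_le C t (i + 1) _)

/-- A burst after time slot `a` that ends with time slot `a + b`. -/
theorem knownCount_burst_eq (hC : LosslessDelay C t 1) (hC' : WorstCaseDelay C τ b t) {a : ℕ}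
    (h : a + b + τ ≤ t) :
    knownCount C t (a + b + τ)
      ≤ knownCount C t a + ∑ l ∈ Ioc (a + b) (a + b + τ), (C.size l : ℤ) := by
  -- The prefix recovered after the burst includes S[a+b], so it determines X[a+b]; lossless
  -- decoding then continues from there.
  have hle : prefixPacketSetoid C t a ⊓ packetsSetoid C t (a + b) (a + b + τ)
      ≤ prefixPacketSetoid C t (a + b + τ) := by
    refine le_trans (le_inf ?_ inf_le_right)
      (prefixPacketSetoid_packets C hC (Nat.le_add_right _ _) h)
    exact (prefixPacketSetoid_burst C hC' (Nat.le_add_right _ _) le_rfl h).trans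
      (prefixSetoid_succ_le C t _)
  have := ceil_le_ceil_add_natCast (n := ∑ l ∈ Ioc (a + b) (a + b + τ), C.size l)
    (((entropy_mono (Fintype.one_lt_card (α := F)) hle).trans
      (entropy_inf_packetsSetoid_le C t (Nat.le_add_right _ _) _)).trans_eq (by push_cast; rfl))
  push_cast at this
  exact this

/-- A burst after time slot `a` that ends with time slot `a + b`, seen in the earlier time
slot `i`. -/
theorem knownCount_burst_lt (hC : LosslessDelay C t 1) (hC' : WorstCaseDelay C τ b t) {a i : ℕ}
    (hai : a ≤ i) (hib : i < a + b) (hbτ : a + b ≤ i + τ) (h : i + τ ≤ t) :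
    messageCount k (i + 1) + knownCount C t (i + τ)
      ≤ knownCount C t a + knownCount C t (a + b)
        + ∑ l ∈ Ioc (a + b) (i + τ), (C.size l : ℤ) := by
  have hq := Fintype.one_lt_card (α := F)
  have h1 := entropy_mono hq (le_inf (prefixPacketSetoid_burst C hC' hai hib.le h)
    (inf_le_right (a := prefixPacketSetoid C t a)))
  have h2 := entropy_inf_packetsSetoid_le C t hbτ (prefixPacketSetoid C t a)
  have hle : prefixPacketSetoid C t (a + b) ≤ prefixSetoid k t (i + 1) :=
    inf_le_left.trans (prefixSetoid_anti t hib)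
  -- The later packets add no more entropy given the prefix and packet at `a + b` than given only
  -- the messages up to `i`.
  have h3 := entropy_submodular hq hle (packetsSetoid C t (a + b) (i + τ))
  have h4 := entropy_mono hq (prefixPacketSetoid_packets C hC hbτ h)
  rw [entropy_prefixSetoid t (by omega)] at h3
  have h5 := Int.ceil_le_ceil (show entropy (Fintype.card F) (prefixPacketSetoid C t (i + τ))
      + (messageCount k (i + 1) : ℕ)
      ≤ entropy (Fintype.card F) (prefixPacketSetoid C t a)
        + entropy (Fintype.card F) (prefixPacketSetoid C t (a + b))
        + (∑ l ∈ Ioc (a + b) (i + τ), C.size l : ℕ) by push_cast; linarith)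
  rw [Int.ceil_add_natCast, Int.ceil_add_natCast] at h5
  -- Two entropies stand on the larger side; subadditivity of the ceiling lets them be rounded up
  -- separately.
  have h6 := Int.ceil_add_le (entropy (Fintype.card F) (prefixPacketSetoid C t a))
    (entropy (Fintype.card F) (prefixPacketSetoid C t (a + b)))
  push_cast at h5
  simp only [knownCount]
  linarith

theorem sum_Ioc_sub_telescope (e : ℕ → ℤ) {a c : ℕ} (h : a ≤ c) :
    ∑ l ∈ Ioc a c, (e l - e (l - 1)) = e c - e a := by
  induction c, h using Nat.le_induction with
  | base => simp
  | succ c h ih =>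
    rw [sum_Ioc_succ_top h, ih, Nat.add_sub_cancel]
    ring

/-- Every code that meets both delay constraints gives a feasible pair of the integer program, in
which the total number of parity symbols is the redundancy of the code. -/
theorem exists_ipFeasible_of_code (hτ : b < τ) (hC : LosslessDelay C t 1)
    (hC' : WorstCaseDelay C τ b t) (hkt : k t = 0) :
    ∃ f p : ℕ → ℕ, IPFeasible τ b t k f p ∧
      ∑ i ∈ range (t + 1), p i + ∑ i ∈ range (t + 1), k i = ∑ i ∈ range (t + 1), C.size i := by
  set e := knownCount C t with he
  have hf : ∀ i ≤ t, (((e i - messageCount k i).toNat : ℕ) : ℤ) = e i - messageCount k i :=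
    fun i hi => Int.toNat_of_nonneg (by linarith [messageCount_le_knownCount C hi])
  have hp : ∀ i, 0 < i → i ≤ t →
      (((C.size i - (e i - if i = 0 then 0 else e (i - 1))).toNat : ℕ) : ℤ)
        = C.size i - (e i - e (i - 1)) := by
    intro i h0 hi
    obtain ⟨j, rfl⟩ : ∃ j, i = j + 1 := ⟨i - 1, by omega⟩
    have := knownCount_succ_le C hC hi
    rw [if_neg h0.ne', Int.toNat_of_nonneg]
    simp only [Nat.add_sub_cancel]
    linarith
  have hsum : ∀ a c, a ≤ c → c ≤ t →
      ∑ l ∈ Ioc a c, (((C.size l - (e l - if l = 0 then 0 else e (l - 1))).toNat : ℕ) : ℤ)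
        = ∑ l ∈ Ioc a c, (C.size l : ℤ) - (e c - e a) := by
    intro a c hac hc
    rw [← sum_Ioc_sub_telescope e hac, ← sum_sub_distrib]
    refine sum_congr rfl fun l hl => hp l ?_ ?_
    · have := mem_Ioc.1 hl; omega
    · have := mem_Ioc.1 hl; omega
  -- `f i` counts what X[i] reveals beyond the earlier messages, `p i` the part of X[i] that adds
  -- nothing new. For `i ≤ t` both differences are nonnegative, so `toNat` loses nothing.
  refine ⟨fun i => (e i - messageCount k i).toNat,
    fun i => (C.size i - (e i - if i = 0 then 0 else e (i - 1))).toNat, ⟨?_, ?_⟩, ?_⟩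
  · intro i hi
    have := hf i hi
    have : e i ≤ _ := knownCount_le_messageCount C hi
    rw [messageCount_succ] at this
    push_cast at this
    dsimp only
    omega
  · intro n hn j hj
    simp only [mem_Icc] at hn hj
    obtain ⟨a, rfl⟩ : ∃ a, j = a + 1 := ⟨j - 1, by omega⟩
    obtain ⟨i, rfl⟩ : ∃ i, n = i + τ := ⟨n - τ, by omega⟩
    simp only [Nat.add_sub_cancel] at hj ⊢
    have hIcc : Icc (a + 1 + b) (i + τ) = Ioc (a + b) (i + τ) := by
      ext x
      simp only [mem_Icc, mem_Ioc]
      omega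
    rw [hIcc, hsum _ _ (by omega) (by omega), sum_Icc_messageCount k (by omega),
      hf a (by omega), hf i (by omega)]
    have hK := messageCount_succ k i
    split_ifs with hab
    · obtain rfl : i = a + b := by omega
      have := knownCount_burst_eq C hC hC' (a := a) (by omega)
      push_cast [hK]
      linarith
    · have := knownCount_burst_lt C hC hC' (a := a) (i := i) (by omega) (by omega) (by omega)
        (by omega)
      linarith
  · have h0 : (((C.size 0 - (e 0 - if (0 : ℕ) = 0 then 0 else e (0 - 1))).toNat : ℕ) : ℤ)
        = C.size 0 - e 0 := by
      have := knownCount_zero_le C (t := t)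
      rw [if_pos rfl, Int.toNat_of_nonneg] <;> linarith
    have hr : ∀ g : ℕ → ℤ, ∑ i ∈ range (t + 1), g i = g 0 + ∑ i ∈ Ioc 0 t, g i := by
      intro g
      rw [range_eq_Ico, sum_eq_sum_Ico_succ_bot (by omega)]
      rfl
    have h1 := hsum 0 t (Nat.zero_le _) le_rfl
    have h2 := messageCount_le_knownCount C (le_refl t)
    have h3 := knownCount_le_messageCount C (le_refl t)
    -- With `k t = 0` the two bounds on `e t` coincide, so the telescoping sum ends at the total
    -- message size.
    rw [messageCount_succ, hkt, add_zero] at h3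
    have h4 : e t = ∑ i ∈ range (t + 1), (k i : ℤ) := by
      rw [sum_range_succ, hkt, Nat.cast_zero, add_zero]
      have : e t = messageCount k t := le_antisymm h3 h2
      rw [this, messageCount, Nat.cast_sum]
    rw [← Nat.cast_inj (R := ℤ)]
    simp only [Nat.cast_add, Nat.cast_sum]
    rw [hr, h0, h1, ← h4, hr (fun i => (C.size i : ℤ))]
    ring

end Converse

/-! ### Counting the parity symbols of the Spread Code -/

theorem sum_Ico_messageCount (p : ℕ → ℕ) {a c : ℕ} (h : a ≤ c) :
    ∑ l ∈ Ico a c, (p l : ℤ) = messageCount p c - messageCount p a := by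
  rw [sum_Ico_eq_sub _ h]
  simp [messageCount]

theorem sum_Icc_pred_sub (k f : ℕ → ℕ) {j i : ℕ} (hj : 0 < j) (h : j ≤ i) :
    ∑ l ∈ Icc j i, ((k (l - 1) : ℤ) - f (l - 1)) + ∑ l ∈ Ico j i, (f l : ℤ)
      = messageCount k i - (messageCount k (j - 1) + f (j - 1)) := by
  induction i, h using Nat.le_induction with
  | base =>
    obtain ⟨a, rfl⟩ : ∃ a, j = a + 1 := ⟨j - 1, by omega⟩
    simp [messageCount_succ]
  | succ i h ih =>
    rw [sum_Icc_succ_top (by omega), sum_Ico_succ_top h, messageCount_succ, Nat.add_sub_cancel]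
    push_cast
    linarith

section Parity

variable {τ b t : ℕ} {k f : ℕ → ℕ}

/-- The bound that a burst in the time slots `a + 1, …, a + b` imposes on `p_{i+τ}`. -/
def burstBound (τ b t : ℕ) (k f : ℕ → ℕ) (i a : ℕ) : ℤ :=
  (if a + b = i then (messageCount k i : ℤ) + f i else messageCount k (i + 1))
    - (messageCount k a + if a = i then (f a : ℤ) else usedPolicy τ b t k f a)
    - (messageCount (parity τ b t k f) (i + τ) - messageCount (parity τ b t k f) (a + b + 1))

/-- The shift `j = a + 1` and prefix sums bring the recursion into the shape of the program's
constraints. -/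
theorem parity_add_eq_sup (hb : 0 < b) (hτ : b < τ) {i : ℕ} (h1 : 2 * τ ≤ i)
    (h2 : i + 2 * τ ≤ t) :
    parity τ b t k f (i + τ)
      = (Icc (i - b) i).sup fun a => (burstBound τ b t k f i a).toNat := by
  rw [parity_eq τ b t k f hb hτ, parityStep, if_pos (by omega)]
  simp only [Nat.add_sub_cancel]
  have himg : Icc (i + 1 - b) (i + 1) = (Icc (i - b) i).image (· + 1) := by
    rw [image_add_right_Icc]
    congr 1
    omega
  rw [himg, sup_image]
  refine sup_congr rfl fun a ha => ?_
  rw [mem_Icc] at ha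
  simp only [Function.comp_apply]
  congr 1
  have hK := messageCount_succ k i
  rw [burstBound, show a + 1 + b = a + b + 1 by ring,
    sum_Ico_messageCount (parity τ b t k f) (a := a + b + 1) (by omega)]
  rcases ha.2.lt_or_eq with hai | rfl
  · have hs := sum_Icc_pred_sub k (spreadPolicy τ t f (parity τ b t k f)) (j := a + 1) (i := i)
      (by omega) hai
    rw [if_pos (show a + 1 ≤ i from hai), if_neg hai.ne]
    simp only [Nat.add_sub_cancel] at hs ⊢
    simp only [usedPolicy]
    by_cases hab : a + b = i
    · rw [if_pos hab, if_neg (by omega)]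
      linarith
    · rw [if_neg hab, if_pos (by omega)]
      push_cast [hK]
      linarith
  · rw [if_neg (by omega : ¬ a + 1 ≤ a), if_pos (by omega), if_neg (by omega), if_pos rfl,
      Icc_eq_empty (by omega), Ico_eq_empty (by omega)]
    push_cast [hK]
    simp only [sum_empty]
    ring

theorem burstBound_le_parity (hb : 0 < b) (hτ : b < τ) {i a : ℕ} (h1 : 2 * τ ≤ i)
    (h2 : i + 2 * τ ≤ t) (ha : i ≤ a + b) (hai : a ≤ i) :
    burstBound τ b t k f i a ≤ parity τ b t k f (i + τ) := by
  rw [parity_add_eq_sup hb hτ h1 h2]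
  refine (Int.self_le_toNat _).trans ?_
  exact_mod_cast le_sup (f := fun a => (burstBound τ b t k f i a).toNat)
    (mem_Icc.2 ⟨by omega, hai⟩)

theorem parity_le_of_burstBound_le (hb : 0 < b) (hτ : b < τ) {i : ℕ} (h1 : 2 * τ ≤ i)
    (h2 : i + 2 * τ ≤ t) {c : ℕ} (h : ∀ a ≤ i, i ≤ a + b → burstBound τ b t k f i a ≤ c) :
    parity τ b t k f (i + τ) ≤ c := by
  rw [parity_add_eq_sup hb hτ h1 h2]
  refine Finset.sup_le fun a ha => ?_
  rw [mem_Icc] at ha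
  exact Int.toNat_le.2 (h a ha.2 (by omega))

theorem parity_eq_zero (hb : 0 < b) (hτ : b < τ) {n : ℕ} (h : n < 3 * τ ∨ t < n + τ) :
    parity τ b t k f n = 0 := by
  rw [parity_eq τ b t k f hb hτ, parityStep, if_neg (by omega)]

theorem usedPolicy_eq_max {i : ℕ} (h1 : 2 * τ ≤ i) (h2 : i + 2 * τ ≤ t) :
    usedPolicy τ b t k f i = max (f i) (parity τ b t k f (i + τ)) := by
  rw [usedPolicy, spreadPolicy, if_neg (by omega)]

theorem usedPolicy_eq_zero {i : ℕ} (h : i < 2 * τ ∨ t < i + 2 * τ) :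
    usedPolicy τ b t k f i = 0 := by
  rw [usedPolicy, spreadPolicy, if_pos h]

theorem parity_le_usedPolicy (hb : 0 < b) (hτ : b < τ) (i : ℕ) :
    parity τ b t k f (i + τ) ≤ usedPolicy τ b t k f i := by
  by_cases h : i < 2 * τ ∨ t < i + 2 * τ
  · rw [parity_eq_zero hb hτ (by omega)]
    exact Nat.zero_le _
  · rw [usedPolicy_eq_max (by omega) (by omega)]
    exact le_max_right _ _

/-- The invariants of the Spread Code: it never has more parity symbols in time slot `i + τ` than
message symbols in time slot `i`, and the constraints on bursts hold for the policy that it really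
uses. -/
theorem parity_invariants (hb : 0 < b) (hτ : b < τ)
    (hpad : ∀ i ≤ t, i < 2 * τ ∨ t < i + 2 * τ → k i = 0) (hf : ∀ i ≤ t, f i ≤ k i) {i : ℕ}
    (hi : i + τ ≤ t) :
    parity τ b t k f (i + τ) ≤ k i ∧ ∀ a ≤ i, i ≤ a + b →
      (if a + b = i then (messageCount k i : ℤ) + usedPolicy τ b t k f i
          else messageCount k (i + 1)) - (messageCount k a + usedPolicy τ b t k f a)
        ≤ messageCount (parity τ b t k f) (i + τ + 1)
          - messageCount (parity τ b t k f) (a + b + 1) := by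
  induction i with
  | zero =>
    refine ⟨by rw [parity_eq_zero hb hτ (by omega)]; exact Nat.zero_le _, fun a ha hab => ?_⟩
    obtain rfl : a = 0 := by omega
    have h1 : messageCount (parity τ b t k f) (0 + b + 1)
        ≤ messageCount (parity τ b t k f) (0 + τ + 1) :=
      sum_le_sum_of_subset (range_mono (by omega))
    rw [if_neg (by omega), messageCount_succ, hpad 0 (by omega) (by omega)]
    zify at h1
    push_cast
    linarith [(usedPolicy τ b t k f 0).cast_nonneg (α := ℤ)]
  | succ i ih =>
    obtain ⟨-, ih⟩ := ih (by omega)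
    have hP := messageCount_succ (parity τ b t k f) (i + 1 + τ)
    have hK := messageCount_succ k (i + 1)
    have hsucc : i + 1 + τ = i + τ + 1 := by ring
    have hmono : ∀ a, a ≤ i + 1 → messageCount (parity τ b t k f) (a + b + 1)
        ≤ messageCount (parity τ b t k f) (i + 1 + τ + 1) :=
      fun a ha => sum_le_sum_of_subset (range_mono (by omega))
    by_cases h : i + 1 < 2 * τ ∨ t < i + 1 + 2 * τ
    · rw [parity_eq_zero hb hτ (by omega)] at hP ⊢
      refine ⟨Nat.zero_le _, fun a ha hab => ?_⟩
      rw [usedPolicy_eq_zero h, hP, hK, hpad (i + 1) (by omega) h]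
      rcases ha.lt_or_eq with hai | rfl
      · have h3 := ih a (by omega) (by omega)
        rw [if_neg (by omega)] at h3
        rw [hsucc]
        split_ifs <;> simpa using h3
      · have h3 := hmono (i + 1) le_rfl
        rw [hP] at h3
        zify at h3
        rw [if_neg (by omega)]
        push_cast
        linarith [(usedPolicy τ b t k f (i + 1)).cast_nonneg (α := ℤ)]
    · have hfi := hf (i + 1) (by omega)
      -- A burst reaching slot `i + 1` ends after slot `i`, so the constraint at `i` already covers
      -- all of S[i]. Only S[i+1] is new, whence at most `k (i + 1)` parity symbols are needed.
      have hbound : ∀ a ≤ i, i + 1 ≤ a + b → (messageCount k (i + 1) : ℤ)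
          - (messageCount k a + usedPolicy τ b t k f a)
          ≤ messageCount (parity τ b t k f) (i + 1 + τ)
            - messageCount (parity τ b t k f) (a + b + 1) := by
        intro a ha hab
        have h3 := ih a ha (by omega)
        rw [if_neg (by omega)] at h3
        rw [hsucc]
        exact h3
      refine ⟨parity_le_of_burstBound_le hb hτ (by omega) (by omega) fun a ha hab => ?_,
        fun a ha hab => ?_⟩
      · rw [burstBound]
        rcases ha.lt_or_eq with hai | rfl
        · have h3 := hbound a (by omega) hab
          rw [if_neg hai.ne]
          split_ifs
          · linarith
          · rw [hK]
            push_cast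
            linarith
        · have h3 : messageCount (parity τ b t k f) (i + 1 + b + 1)
              ≤ messageCount (parity τ b t k f) (i + 1 + τ) :=
            sum_le_sum_of_subset (range_mono (by omega))
          rw [if_neg (by omega), if_pos rfl, hK]
          push_cast
          linarith [(f (i + 1)).cast_nonneg (α := ℤ)]
      · have h3 := burstBound_le_parity (k := k) (f := f) (t := t) hb hτ (i := i + 1) (by omega) (by omega)
          hab ha
        have hmax := usedPolicy_eq_max (b := b) (k := k) (f := f) (t := t) (i := i + 1)
          (show 2 * τ ≤ i + 1 by omega) (by omega)
        rw [burstBound] at h3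
        rw [hP]
        push_cast
        rcases ha.lt_or_eq with hai | rfl
        · rw [if_neg hai.ne] at h3
          split_ifs at h3 ⊢ with hab'
          · have h4 := hbound a (by omega) hab
            rw [hmax]
            -- If f' = f, this is the bound for which the parity count was chosen; if f' is the
            -- parity count, both sides of `h4` grow by that same amount.
            rcases max_choice (f (i + 1)) (parity τ b t k f (i + 1 + τ)) with hc | hc
            · rw [hc]
              linarith
            · rw [hc]
              linarith
          · linarith
        · rw [if_neg (by omega), if_pos rfl] at h3
          rw [if_neg (by omega)]
          have : (f (i + 1) : ℤ) ≤ usedPolicy τ b t k f (i + 1) := by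
            rw [hmax]
            exact_mod_cast le_max_left _ _
          linarith

theorem parity_add_le (hb : 0 < b) (hτ : b < τ)
    (hpad : ∀ i ≤ t, i < 2 * τ ∨ t < i + 2 * τ → k i = 0) (hf : ∀ i ≤ t, f i ≤ k i) (i : ℕ) :
    parity τ b t k f (i + τ) ≤ k i := by
  by_cases hi : i + τ ≤ t
  · exact (parity_invariants hb hτ hpad hf hi).1
  · rw [parity_eq_zero hb hτ (by omega)]
    exact Nat.zero_le _

theorem usedPolicy_le (hb : 0 < b) (hτ : b < τ)
    (hpad : ∀ i ≤ t, i < 2 * τ ∨ t < i + 2 * τ → k i = 0) (hf : ∀ i ≤ t, f i ≤ k i) (i : ℕ) :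
    usedPolicy τ b t k f i ≤ k i := by
  by_cases h : i < 2 * τ ∨ t < i + 2 * τ
  · rw [usedPolicy_eq_zero h]
    exact Nat.zero_le _
  · rw [usedPolicy_eq_max (by omega) (by omega)]
    exact max_le (hf i (by omega)) (parity_add_le hb hτ hpad hf i)

theorem parity_le (hb : 0 < b) (hτ : b < τ) {m : ℕ} (hkm : ∀ i ≤ t, k i ≤ m)
    (hpad : ∀ i ≤ t, i < 2 * τ ∨ t < i + 2 * τ → k i = 0) (hf : ∀ i ≤ t, f i ≤ k i) (n : ℕ) :
    parity τ b t k f n ≤ m := by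
  by_cases h : n < 3 * τ ∨ t < n + τ
  · rw [parity_eq_zero hb hτ h]
    exact Nat.zero_le _
  · obtain ⟨i, rfl⟩ : ∃ i, n = i + τ := ⟨n - τ, by omega⟩
    exact (parity_add_le hb hτ hpad hf i).trans (hkm i (by omega))

/-- Up to the parity count, the length of V is an increment of `messageCount k i + usedPolicy τ b t
k f i`, so sums over slots telescope. The subtractions in `lenV` are exact as f' ≤ k and U is no
longer than f'. -/
theorem lenV_add_parity (hb : 0 < b) (hτ : b < τ)
    (hpad : ∀ i ≤ t, i < 2 * τ ∨ t < i + 2 * τ → k i = 0) (hf : ∀ i ≤ t, f i ≤ k i) (i : ℕ) :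
    lenV τ b t k f (i + 1) + parity τ b t k f (i + 1 + τ) + messageCount k i
        + usedPolicy τ b t k f i
      = messageCount k (i + 1) + usedPolicy τ b t k f (i + 1) := by
  have h1 := usedPolicy_le hb hτ hpad hf i
  have h2 := parity_le_usedPolicy (k := k) (f := f) (t := t) hb hτ (i + 1)
  rw [lenV, messageCount_succ, Nat.add_sub_cancel]
  omega

theorem lenV_le (hb : 0 < b) (hτ : b < τ) {m : ℕ} (hkm : ∀ i ≤ t, k i ≤ m)
    (hpad : ∀ i ≤ t, i < 2 * τ ∨ t < i + 2 * τ → k i = 0) (hf : ∀ i ≤ t, f i ≤ k i) {i : ℕ}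
    (hi : i ≤ t) : lenV τ b t k f i ≤ 2 * m := by
  have h1 := usedPolicy_le hb hτ hpad hf i
  have h2 := hkm i hi
  have h3 := hkm (i - 1) (by omega)
  rw [lenV]
  omega

/-- The parity symbols sent in the time slots `a + b + 1, …, a + τ` suffice for the lost symbols of
the `V[l]`, when the packets of the time slots `a + 1, …, a + b` are lost. -/
theorem sum_lenV_le (hb : 0 < b) (hτ : b < τ)
    (hpad : ∀ i ≤ t, i < 2 * τ ∨ t < i + 2 * τ → k i = 0) (hf : ∀ i ≤ t, f i ≤ k i) {a : ℕ}
    (ha : a + b + τ ≤ t) :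
    ∑ l ∈ Ico (a + 1) (a + 1 + b), lenV τ b t k f l
      ≤ ∑ n ∈ Ico (a + 1 + b) (a + 1 + τ), parity τ b t k f n := by
  -- V omits the symbols of U, which removes the parity of slots `a + τ + 1, …, a + c + τ`. This is
  -- why recovery of V can end at slot `a + τ`.
  have hsum : ∀ c, ∑ l ∈ Ico (a + 1) (a + 1 + c), lenV τ b t k f l
      + (messageCount (parity τ b t k f) (a + c + τ + 1)
        + (messageCount k a + usedPolicy τ b t k f a))
      = messageCount k (a + c) + usedPolicy τ b t k f (a + c)
        + messageCount (parity τ b t k f) (a + τ + 1) := by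
    intro c
    induction c with
    | zero => simp; ring
    | succ c ih =>
      have h1 := lenV_add_parity hb hτ hpad hf (a + c)
      have h2 := messageCount_succ (parity τ b t k f) (a + c + τ + 1)
      rw [show a + c + 1 + τ = a + c + τ + 1 by ring] at h1
      rw [show a + 1 + (c + 1) = a + 1 + c + 1 by ring, sum_Ico_succ_top (by omega),
        show a + 1 + c = a + c + 1 by ring, show a + (c + 1) + τ + 1 = a + c + τ + 1 + 1 by ring,
        show a + (c + 1) = a + c + 1 by ring]
      rw [show a + 1 + c = a + c + 1 by ring] at ih
      omega
  have h1 := hsum b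
  have h2 := (parity_invariants hb hτ hpad hf ha).2 a (by omega) le_rfl
  have h3 := sum_Ico_messageCount (parity τ b t k f) (a := a + 1 + b) (c := a + 1 + τ) (by omega)
  rw [if_pos rfl] at h2
  rw [show a + 1 + τ = a + τ + 1 by ring] at h3 ⊢
  zify at h1 ⊢
  rw [h3, show a + 1 + b = a + b + 1 by ring]
  rw [show a + 1 + b = a + b + 1 by ring] at h1
  linarith

/-- Up to every time slot, the Spread Code for `f` sends at most as many parity symbols as any
feasible pair `(f, p)` of the integer program has. -/
theorem messageCount_parity_le (hb : 0 < b) (hτ : b < τ)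
    (hpad : ∀ i ≤ t, i < 2 * τ ∨ t < i + 2 * τ → k i = 0) {p : ℕ → ℕ}
    (hp : IPFeasible τ b t k f p) (n : ℕ) :
    messageCount (parity τ b t k f) n ≤ messageCount p n := by
  induction n using Nat.strong_induction_on with
  | _ n ih =>
    rcases n with _ | n
    · simp [messageCount]
    rw [messageCount_succ, messageCount_succ]
    have ihn := ih n (Nat.lt_succ_self n)
    by_cases h : n < 3 * τ ∨ t < n + τ
    · rw [parity_eq_zero hb hτ h]
      omega
    obtain ⟨i, rfl⟩ : ∃ i, n = i + τ := ⟨n - τ, by omega⟩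
    suffices hs : parity τ b t k f (i + τ) ≤ messageCount p (i + τ) + p (i + τ)
        - messageCount (parity τ b t k f) (i + τ) by omega
    refine parity_le_of_burstBound_le hb hτ (by omega) (by omega) fun a ha hab => ?_
    have h1 := hp.2 (i + τ) (by simp; omega) (a + 1) (by simp; omega)
    have h2 := ih (a + b + 1) (by omega)
    have hK := messageCount_succ k i
    have hP := messageCount_succ p (i + τ)
    -- Enlarging the policy only weakens the burst bound; in the initial padding `f a` is 0.
    have hu : (f a : ℤ) ≤ usedPolicy τ b t k f a := by
      rcases lt_or_ge a (2 * τ) with ha2 | ha2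
      · have := hp.1 a (by omega)
        rw [hpad a (by omega) (Or.inl ha2)] at this
        omega
      · rw [usedPolicy_eq_max ha2 (by omega)]
        exact_mod_cast le_max_left _ _
    simp only [Nat.add_sub_cancel] at h1
    rw [sum_Icc_messageCount k (by omega), sum_Icc_messageCount p (by omega),
      show a + 1 + b = a + b + 1 by ring, Nat.add_sub_cancel, hP] at h1
    rw [burstBound, Nat.cast_sub (by omega)]
    push_cast at h1 ⊢
    zify at h2
    split_ifs at h1 ⊢ <;> linarith

end Parity

/-! ### Cauchy matrices -/

section Cauchy

open Polynomial

variable {F : Type*} [Field F]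

/-- A vector whose support is at most as large as a set of columns of a Cauchy matrix is determined
by its products with these columns. -/
theorem IsCauchyMatrix.eq_zero_of_vecMul_eq_zero {N : ℕ} {A : Matrix (Fin N) (Fin N) F}
    (hA : IsCauchyMatrix A) (w : Fin N → F) (R S : Finset (Fin N)) (hRS : R.card ≤ S.card)
    (hw : ∀ r ∉ R, w r = 0) (h : ∀ c ∈ S, Matrix.vecMul w A c = 0) : w = 0 := by
  obtain ⟨x, y, hx, hy, hxy, hA⟩ := hA
  -- The numerator of ∑ w_r / (x_r - X) over the common denominator: it vanishes at the `y c` with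
  -- `c ∈ S`, which are too many roots for its degree.
  set Q : F[X] := ∑ r ∈ R, C (w r) * ∏ s ∈ R.erase r, (C (x s) - X) with hQ
  have hdeg : Q.degree < S.card := by
    rw [← mem_degreeLT]
    refine Submodule.sum_mem _ fun r hr => ?_
    rw [mem_degreeLT]
    refine lt_of_le_of_lt degree_le_natDegree ?_
    have h1 : (C (w r) * ∏ s ∈ R.erase r, (C (x s) - X)).natDegree ≤ (R.erase r).card := by
      refine (natDegree_C_mul_le _ _).trans ((natDegree_prod_le _ _).trans ?_)
      refine (sum_le_card_nsmul _ _ 1 fun s _ => ?_).trans (by simp)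
      exact (natDegree_sub_le _ _).trans (by simp)
    have h2 := card_erase_lt_of_mem hr
    exact_mod_cast (h1.trans_lt h2).trans_le hRS
  have hQ0 : Q = 0 := by
    refine eq_zero_of_degree_lt_of_eval_index_eq_zero S (v := y) hy.injOn hdeg fun c hc => ?_
    have h1 : Q.eval (y c) = (∏ s ∈ R, (x s - y c)) * Matrix.vecMul w A c := by
      have h2 : Matrix.vecMul w A c = ∑ r ∈ R, w r * A r c := by
        rw [Matrix.vecMul, dotProduct]
        refine (sum_subset (subset_univ R) fun r _ hr => ?_).symm
        rw [hw r hr, zero_mul]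
      rw [h2, mul_sum, hQ, eval_finsetSum]
      refine sum_congr rfl fun r hr => ?_
      rw [eval_mul, eval_C, eval_prod, ← mul_prod_erase R _ hr, hA]
      simp only [eval_sub, eval_C, eval_X]
      have := sub_ne_zero.2 (hxy r c)
      field_simp
    rw [h1, h c hc, mul_zero]
  funext r
  by_cases hr : r ∈ R
  -- At `x r` only the term of `r` survives, so `Q = 0` forces `w r = 0`.
  · have h1 : Q.eval (x r) = w r * ∏ s ∈ R.erase r, (x s - x r) := by
      rw [hQ, eval_finsetSum, sum_eq_single_of_mem r hr]
      · simp [eval_prod]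
      · intro r' hr' hne
        rw [eval_mul, eval_prod, prod_eq_zero (mem_erase.2 ⟨hne.symm, hr⟩) (by simp), mul_zero]
    rw [hQ0, eval_zero, eq_comm, mul_eq_zero] at h1
    refine h1.resolve_right (prod_ne_zero_iff.2 fun s hs => ?_)
    exact sub_ne_zero.2 fun he => (mem_erase.1 hs).1 (hx he)
  · exact hw r hr

end Cauchy

/-! ### Decoding and length of the Spread Code -/

section SpreadCode

variable {F : Type*} [Field F] {τ b t m : ℕ} {k f : ℕ → ℕ}
  {A : Matrix (Fin (2 * m * τ)) (Fin (2 * m * τ)) F} {s s' : Messages F k}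

theorem sym_congr {i : ℕ} (h : s i = s' i) (r : ℕ) : sym s i r = sym s' i r := by
  simp only [sym, h]

theorem partV_congr {i : ℕ} (h : s i = s' i) (h' : s (i - 1) = s' (i - 1)) :
    partV τ b t k f s i = partV τ b t k f s' i := by
  unfold partV
  congr 1
  · exact funext fun r => sym_congr h _
  · exact funext fun r => sym_congr h' _

/-- A message packet is determined by the parts that are sent in its own and in the following time
slot. -/
theorem message_eq_of_parts {i : ℕ} (hU : partU τ b t k f s i = partU τ b t k f s' i)
    (hV : partV τ b t k f s i = partV τ b t k f s' i)
    (hV' : partV τ b t k f s (i + 1) = partV τ b t k f s' (i + 1)) : s i = s' i := by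
  funext r
  suffices h : sym s i r = sym s' i r by simpa [sym] using h
  rcases lt_or_ge (r : ℕ) (parity τ b t k f (i + τ)) with h1 | h1
  · exact congrFun hU ⟨r, h1⟩
  rcases lt_or_ge (r : ℕ) (usedPolicy τ b t k f i) with h2 | h2
  · have h := congrFun hV (Fin.castAdd _ ⟨r - parity τ b t k f (i + τ), by omega⟩)
    simp only [partV, Fin.append_left] at h
    rwa [Nat.add_sub_cancel' h1] at h
  · have h := congrFun hV' (Fin.natAdd _ ⟨r - usedPolicy τ b t k f i, by
      have := r.2
      simp only [Nat.add_sub_cancel]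
      omega⟩)
    simp only [partV, Fin.append_right, Nat.add_sub_cancel] at h
    rwa [Nat.add_sub_cancel' h2] at h

theorem parts_eq_of_enc_eq {i : ℕ}
    (h : (spreadCode τ b t m k f A).enc i s = (spreadCode τ b t m k f A).enc i s') :
    partU τ b t k f s i = partU τ b t k f s' i ∧ partV τ b t k f s i = partV τ b t k f s' i ∧
      partP τ b t m k f A s i = partP τ b t m k f A s' i := by
  change Fin.append (Fin.append _ _) _ = Fin.append (Fin.append _ _) _ at h
  refine ⟨funext fun r => ?_, funext fun r => ?_, funext fun r => ?_⟩
  · simpa using congrFun h (Fin.castAdd _ (Fin.castAdd _ r))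
  · simpa using congrFun h (Fin.castAdd _ (Fin.natAdd _ r))
  · simpa using congrFun h (Fin.natAdd _ r)

theorem vecW_congr {i : ℕ}
    (h : ∀ l, i - τ ≤ l → l < i → partV τ b t k f s l = partV τ b t k f s' l) :
    vecW τ b t m k f s i = vecW τ b t m k f s' i := by
  funext r
  refine sum_congr rfl fun j hj => ?_
  rw [h j (mem_Ico.1 hj).1 (mem_Ico.1 hj).2]

/-- `U[i]` is determined by `P[i+τ]` and the vectors `V[i], …, V[i+τ-1]`. -/
theorem partU_eq_of_partP {i : ℕ}
    (hP : partP τ b t m k f A s (i + τ) = partP τ b t m k f A s' (i + τ))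
    (hV : ∀ l, i ≤ l → l < i + τ → partV τ b t k f s l = partV τ b t k f s' l) :
    partU τ b t k f s i = partU τ b t k f s' i := by
  funext c
  have h := congrFun hP c
  have hW : vecW τ b t m k f s (i + τ) = vecW τ b t m k f s' (i + τ) :=
    vecW_congr fun l hl => hV l (by omega)
  simp only [partP, partPv, hW, Nat.add_sub_cancel] at h
  exact add_right_cancel h

/-- The contribution to `W` of the difference of two values of `V` in the time slots
`a + 1, …, a + b`. -/
def burstDiff (τ b t m : ℕ) (k f : ℕ → ℕ) (s s' : Messages F k) (a : ℕ) : Fin (2 * m * τ) → F :=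
  fun r => ∑ j ∈ Ico (a + 1) (a + 1 + b),
    if j % τ = (r : ℕ) / (2 * m) then
      (if h : (r : ℕ) % (2 * m) < lenV τ b t k f j then
        partV τ b t k f s j ⟨(r : ℕ) % (2 * m), h⟩ - partV τ b t k f s' j ⟨(r : ℕ) % (2 * m), h⟩
        else 0)
    else 0

/-- For each such `n` the window `n - τ, …, n - 1` contains the whole burst, and V agrees on the
rest of it. All these parity packets therefore test the same difference vector. -/
theorem vecW_sub_vecW {a n : ℕ} (h1 : a + b < n) (h2 : n ≤ a + τ)
    (hV : ∀ l ≤ a, partV τ b t k f s l = partV τ b t k f s' l)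
    (hV' : ∀ l, a + b < l → l < a + τ → partV τ b t k f s l = partV τ b t k f s' l) :
    vecW τ b t m k f s n - vecW τ b t m k f s' n = burstDiff τ b t m k f s s' a := by
  funext r
  rw [Pi.sub_apply, vecW, vecW, ← sum_sub_distrib, burstDiff]
  symm
  refine (sum_subset ?_ ?_).trans (sum_congr rfl fun j _ => ?_)
  · exact Ico_subset_Ico (by omega) (by omega)
  · intro j hj hj'
    simp only [mem_Ico] at hj hj'
    have : partV τ b t k f s j = partV τ b t k f s' j := by
      rcases le_or_gt j a with h | h
      · exact hV j h
      · exact hV' j (by omega) (by omega)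
    simp [this]
  · split_ifs <;> simp

theorem mul_add_inj {m x y c d : ℕ} (hc : c < m) (hd : d < m) (h : m * x + c = m * y + d) :
    x = y ∧ c = d := by
  have h1 : (m * x + c) / m = x := by
    rw [Nat.mul_add_div (by omega), Nat.div_eq_of_lt hc, add_zero]
  have h2 : (m * y + d) / m = y := by
    rw [Nat.mul_add_div (by omega), Nat.div_eq_of_lt hd, add_zero]
  have h3 : x = y := by rw [← h1, ← h2, h]
  subst h3
  exact ⟨rfl, by omega⟩

/-- Keeps the blocks of W, and the column blocks of `A`, disjoint for different slots. -/
theorem eq_of_mod_eq_of_mem_Ico {a i j : ℕ} (hi : a < i) (hi' : i ≤ a + τ) (hj : a < j)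
    (hj' : j ≤ a + τ) (h : i % τ = j % τ) : i = j :=
  Nat.mod_injOn_Ico (a + 1) τ (by simp; omega) (by simp; omega) h

theorem mul_add_lt {x c : ℕ} (hx : x < τ) (hc : c < 2 * m) : 2 * m * x + c < 2 * m * τ :=
  calc 2 * m * x + c < 2 * m * (x + 1) := by rw [mul_add_one]; omega
    _ ≤ 2 * m * τ := Nat.mul_le_mul_left _ hx

/-- Since `n - τ ≤ a`, the summand U[n-τ] of P[n] predates the burst and cancels. -/
theorem vecMul_burstDiff (hb : 0 < b) (hτ : b < τ) {a n d : ℕ} (h1 : a + b < n) (h2 : n ≤ a + τ)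
    (hU : ∀ l ≤ a, partU τ b t k f s l = partU τ b t k f s' l)
    (hV : ∀ l ≤ a, partV τ b t k f s l = partV τ b t k f s' l)
    (hV' : ∀ l, a + b < l → l < a + τ → partV τ b t k f s l = partV τ b t k f s' l)
    (hP : partP τ b t m k f A s n = partP τ b t m k f A s' n) (hd : d < parity τ b t k f n)
    (hlt : 2 * m * (n % τ) + d < 2 * m * τ) :
    Matrix.vecMul (burstDiff τ b t m k f s s' a) A ⟨2 * m * (n % τ) + d, hlt⟩ = 0 := by
  have hnτ : 3 * τ ≤ n := by
    by_contra hn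
    rw [parity_eq_zero hb hτ (by omega)] at hd
    omega
  have h3 := congrFun hP ⟨d, hd⟩
  have h4 : sym s (n - τ) d = sym s' (n - τ) d :=
    congrFun (hU (n - τ) (by omega)) ⟨d, by rwa [Nat.sub_add_cancel (by omega)]⟩
  simp only [partP, partPv, h4, dif_pos hlt] at h3
  rw [← vecW_sub_vecW h1 h2 hV hV', Matrix.sub_vecMul, Pi.sub_apply, add_left_cancel h3, sub_self]

theorem burstDiff_apply {a l : ℕ} (hl : a < l) (hl' : l ≤ a + b) (hτ : b < τ)
    (c : Fin (lenV τ b t k f l)) (hc : (c : ℕ) < 2 * m)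
    (hlt : 2 * m * (l % τ) + c < 2 * m * τ) :
    burstDiff τ b t m k f s s' a ⟨2 * m * (l % τ) + c, hlt⟩
      = partV τ b t k f s l c - partV τ b t k f s' l c := by
  have hdiv : (2 * m * (l % τ) + c) / (2 * m) = l % τ := by
    rw [Nat.mul_add_div (by omega), Nat.div_eq_of_lt hc, add_zero]
  have hmod : (2 * m * (l % τ) + c) % (2 * m) = c := by
    rw [Nat.mul_add_mod, Nat.mod_eq_of_lt hc]
  rw [burstDiff, sum_eq_single_of_mem l (by simp; omega)]
  · simp only [hdiv, hmod, if_true, c.2, dif_pos]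
  · intro j hj hne
    rw [mem_Ico] at hj
    rw [if_neg]
    simp only [hdiv]
    exact fun he => hne (eq_of_mod_eq_of_mem_Ico (a := a) (by omega) (by omega) (by omega)
      (by omega) he)

/-- The vectors `V[a+1], …, V[a+b]` are determined by the packets around the burst. -/
theorem partV_eq_of_burst (hb : 0 < b) (hτ : b < τ) (hkm : ∀ i ≤ t, k i ≤ m)
    (hpad : ∀ i ≤ t, i < 2 * τ ∨ t < i + 2 * τ → k i = 0) (hf : ∀ i ≤ t, f i ≤ k i)
    (hA : IsCauchyMatrix A) {a : ℕ} (ha : a + b + τ ≤ t)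
    (hU : ∀ l ≤ a, partU τ b t k f s l = partU τ b t k f s' l)
    (hV : ∀ l ≤ a, partV τ b t k f s l = partV τ b t k f s' l)
    (hV' : ∀ l, a + b < l → l < a + τ → partV τ b t k f s l = partV τ b t k f s' l)
    (hP : ∀ l, a + b < l → l ≤ a + τ → partP τ b t m k f A s l = partP τ b t m k f A s' l)
    {l : ℕ} (hl : a < l) (hl' : l ≤ a + b) :
    partV τ b t k f s l = partV τ b t k f s' l := by
  classical
  have hτ0 : 0 < τ := by omega
  set w := burstDiff τ b t m k f s s' a with hw
  -- `R` holds the rows that lost symbols can occupy, `S` the columns of the surviving parity. An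
  -- upper bound for `R` and a lower one for `S` suffice, so `g` must be injective only on `SS`.
  set RR := (Ico (a + 1) (a + 1 + b)).sigma fun l => range (lenV τ b t k f l) with hRR
  set SS := (Ico (a + 1 + b) (a + 1 + τ)).sigma fun n => range (parity τ b t k f n) with hSS
  set g : (_ : ℕ) × ℕ → ℕ := fun x => 2 * m * (x.1 % τ) + x.2 with hg
  set R : Finset (Fin (2 * m * τ)) := univ.filter fun r => (r : ℕ) ∈ RR.image g with hR
  set S : Finset (Fin (2 * m * τ)) := univ.filter fun r => (r : ℕ) ∈ SS.image g with hS
  have hlen : ∀ l ≤ a + b, lenV τ b t k f l ≤ 2 * m :=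
    fun l hl => lenV_le hb hτ hkm hpad hf (by omega)
  have hpar : ∀ {n c : ℕ}, c < parity τ b t k f n → c < 2 * m := fun {n c} hc => by
    have := parity_le hb hτ hkm hpad hf n
    omega
  have hRcard : R.card ≤ RR.card := by
    rw [← card_map Fin.valEmbedding]
    refine (card_le_card fun x hx => ?_).trans (card_image_le (f := g))
    obtain ⟨r, hr, rfl⟩ := mem_map.1 hx
    exact (mem_filter.1 hr).2
  have hScard : SS.card ≤ S.card := by
    have hinj : Set.InjOn g SS := by
      rintro ⟨n, c⟩ hn ⟨n', c'⟩ hn' h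
      simp only [hSS, coe_sigma, Set.mem_sigma_iff, mem_coe, mem_Ico, mem_range] at hn hn'
      obtain ⟨h1, rfl⟩ := mul_add_inj (hpar hn.2) (hpar hn'.2) h
      obtain rfl : n = n' :=
        eq_of_mod_eq_of_mem_Ico (a := a) (by omega) (by omega) (by omega) (by omega) h1
      rfl
    rw [← card_image_of_injOn hinj, ← card_map (s := S) Fin.valEmbedding]
    refine card_le_card fun x hx => ?_
    obtain ⟨⟨n, c⟩, hn, rfl⟩ := mem_image.1 hx
    have hc := (mem_sigma.1 hn).2
    simp only [mem_range] at hc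
    exact mem_map.2 ⟨⟨_, mul_add_lt (Nat.mod_lt n hτ0) (hpar hc)⟩,
      mem_filter.2 ⟨mem_univ _, hx⟩, rfl⟩
  have hcard : R.card ≤ S.card := by
    refine hRcard.trans (le_trans ?_ hScard)
    rw [hRR, hSS, card_sigma, card_sigma]
    simp only [card_range]
    exact sum_lenV_le hb hτ hpad hf ha
  have hw0 : w = 0 := by
    refine hA.eq_zero_of_vecMul_eq_zero w R S hcard (fun r hr => ?_) fun c hc => ?_
    · rw [hw, burstDiff]
      refine sum_eq_zero fun j hj => ?_
      split_ifs with h1 h2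
      · have hmem : (r : ℕ) ∈ RR.image g := by
          rw [mem_image]
          refine ⟨⟨j, (r : ℕ) % (2 * m)⟩, mem_sigma.2 ⟨hj, mem_range.2 h2⟩, ?_⟩
          simp only [hg]
          rw [h1, Nat.div_add_mod]
        exact absurd (mem_filter.2 ⟨mem_univ r, hmem⟩) hr
      · rfl
      · rfl
    · obtain ⟨⟨n, d⟩, hn, hnc⟩ := mem_image.1 (mem_filter.1 hc).2
      simp only [hSS, mem_sigma, mem_Ico, mem_range] at hn
      obtain ⟨⟨hn1, hn2⟩, hd⟩ := hn
      have hlt := mul_add_lt (m := m) (Nat.mod_lt n hτ0) (hpar hd)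
      obtain rfl : ⟨2 * m * (n % τ) + d, hlt⟩ = c := Fin.ext hnc
      exact vecMul_burstDiff hb hτ (by omega) (by omega) hU hV hV' (hP n (by omega) (by omega)) hd
        hlt
  funext c
  have hc : (c : ℕ) < 2 * m := c.2.trans_le (hlen l hl')
  have hlt := mul_add_lt (Nat.mod_lt l hτ0) hc
  rw [← sub_eq_zero, ← burstDiff_apply hl hl' hτ c hc hlt, ← hw, hw0, Pi.zero_apply]

theorem spreadCode_losslessDelay (hτ : 0 < τ)
    (hpad : ∀ i ≤ t, i < 2 * τ ∨ t < i + 2 * τ → k i = 0) :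
    LosslessDelay (spreadCode τ b t m k f A) t 1 := by
  refine fun i hi => decodableBy_of_forall fun L hL s s' h => ?_
  rw [Set.mem_singleton_iff] at hL
  subst hL
  by_cases hp : i < 2 * τ ∨ t < i + 2 * τ
  · funext r
    exact (Fin.cast (hpad i hi hp) r).elim0
  have h1 := parts_eq_of_enc_eq (h i (by omega) (Set.notMem_empty _))
  have h2 := parts_eq_of_enc_eq (h (i + 1) (by omega) (Set.notMem_empty _))
  exact message_eq_of_parts h1.1 h1.2.1 h2.2.1

theorem spreadCode_worstCaseDelay (hb : 0 < b) (hτ : b < τ) (hkm : ∀ i ≤ t, k i ≤ m)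
    (hpad : ∀ i ≤ t, i < 2 * τ ∨ t < i + 2 * τ → k i = 0) (hf : ∀ i ≤ t, f i ≤ k i)
    (hA : IsCauchyMatrix A) : WorstCaseDelay (spreadCode τ b t m k f A) τ b t := by
  refine fun i hi => decodableBy_of_forall fun L hL s s' h => ?_
  induction i using Nat.strong_induction_on with
  | _ i ih =>
    by_cases hp : i < 2 * τ ∨ t < i + 2 * τ
    · funext r
      exact (Fin.cast (hpad i hi hp) r).elim0
    -- Earlier deadlines have passed, so all earlier messages agree by induction.
    have hs : ∀ l < i, s l = s' l := fun l hl =>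
      ih l hl (by omega) fun n hn => h n (by omega)
    have hU : ∀ l < i, partU τ b t k f s l = partU τ b t k f s' l := fun l hl =>
      funext fun r => sym_congr (hs l hl) r
    have hV : ∀ l < i, partV τ b t k f s l = partV τ b t k f s' l := fun l hl =>
      partV_congr (hs l hl) (hs (l - 1) (by omega))
    have hX : ∀ l ≤ i + τ, l ∉ L → _ := fun l hl hlL =>
      parts_eq_of_enc_eq (h l (by omega) hlL)
    -- If X[i] is lost, all of `i, …, i + b - 1` is treated as lost: parity up to slot `i - 1 + τ`
    -- gives V, and then P[i+τ] gives U[i].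
    by_cases hiL : i ∈ L
    · have hrec : ∀ l, i + b ≤ l → l ≤ i + τ → _ := fun l hl hl' =>
        hX l hl' (not_mem_admissible hL hiL (by omega) hl (by omega))
      have hVb : ∀ l, i ≤ l → l < i + τ → partV τ b t k f s l = partV τ b t k f s' l := by
        intro l hl hl'
        rcases lt_or_ge l (i + b) with hlb | hlb
        · exact partV_eq_of_burst hb hτ hkm hpad hf hA (a := i - 1) (by omega)
            (fun l hl => hU l (by omega)) (fun l hl => hV l (by omega))
            (fun l hl hl' => (hrec l (by omega) (by omega)).2.1)
            (fun l hl hl' => (hrec l (by omega) (by omega)).2.2) (by omega) (by omega)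
        · exact (hrec l hlb hl'.le).2.1
      exact message_eq_of_parts
        (partU_eq_of_partP (hrec (i + τ) (by omega) le_rfl).2.2 hVb)
        (hVb i le_rfl (by omega)) (hVb (i + 1) (by omega) (by omega))
    · have hi0 := hX i (by omega) hiL
      -- With X[i] received, only the symbols of S[i] in V[i+1] can be missing. The burst is `i + 1,
      -- …, i + b`, and its parity ends exactly at the deadline `i + τ`.
      by_cases hiL' : i + 1 ∈ L
      · have hrec : ∀ l, i + b < l → l ≤ i + τ → _ := fun l hl hl' =>
          hX l hl' (not_mem_admissible hL hiL' (by omega) (by omega) (by omega))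
        refine message_eq_of_parts hi0.1 hi0.2.1 ?_
        refine partV_eq_of_burst hb hτ hkm hpad hf hA (a := i) (by omega)
          (fun l hl => ?_) (fun l hl => ?_) (fun l hl hl' => (hrec l hl (by omega)).2.1)
          (fun l hl hl' => (hrec l hl hl').2.2) (by omega) (by omega)
        · rcases hl.lt_or_eq with hl | rfl
          · exact hU l hl
          · exact hi0.1
        · rcases hl.lt_or_eq with hl | rfl
          · exact hV l hl
          · exact hi0.2.1
      · exact message_eq_of_parts hi0.1 hi0.2.1 (hX (i + 1) (by omega) hiL').2.1

/-- The Spread Code sends every message symbol once, together with its parity symbols. -/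
theorem sum_spreadCode_size (hb : 0 < b) (hτ : b < τ)
    (hpad : ∀ i ≤ t, i < 2 * τ ∨ t < i + 2 * τ → k i = 0) (hf : ∀ i ≤ t, f i ≤ k i) :
    ∑ i ∈ range (t + 1), (spreadCode τ b t m k f A).size i
      = messageCount k (t + 1) + messageCount (parity τ b t k f) (t + 1) := by
  -- Through slot `n`, besides parity, all messages before `n` and the first f'_n symbols of S[n]
  -- have been sent.
  have h : ∀ n, ∑ i ∈ range (n + 1), (parity τ b t k f (i + τ) + lenV τ b t k f i
      + parity τ b t k f i) = messageCount k n + usedPolicy τ b t k f n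
        + messageCount (parity τ b t k f) (n + 1) := by
    intro n
    induction n with
    | zero =>
      simp [messageCount, lenV, usedPolicy_eq_zero (b := b) (k := k) (f := f)
        (show 0 < 2 * τ ∨ t < 0 + 2 * τ by omega), parity_eq_zero (k := k) (f := f) (t := t) hb hτ
        (show τ < 3 * τ ∨ t < τ + τ by omega), hpad 0 (by omega) (by omega)]
    | succ n ih =>
      have h1 := lenV_add_parity hb hτ hpad hf n
      have h2 := messageCount_succ (parity τ b t k f) (n + 1)
      rw [sum_range_succ, ih]
      omega
  refine (h t).trans ?_
  rw [usedPolicy_eq_zero (by omega), messageCount_succ k, hpad t le_rfl (by omega)]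

end SpreadCode

end Streaming

/-! ### Rate optimality -/

theorem mainTheorem1 {F : Type*} [Field F] [Fintype F] (τ b t m : ℕ)
    (hb : 0 < b) (hτ : b < τ) (ht : 4 * τ ≤ t) (hm : 0 < m)
    (k : ℕ → ℕ) (hkm : ∀ i ≤ t, k i ≤ m)
    (hpad : ∀ i ≤ t, i < 2 * τ ∨ t < i + 2 * τ → k i = 0)
    (A : Matrix (Fin (2 * m * τ)) (Fin (2 * m * τ)) F) (hA : Streaming.IsCauchyMatrix A)
    (f : ℕ → ℕ) (hf : Streaming.IsIPOutput τ b t k f) :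
    Streaming.IsRateOptimal (Streaming.spreadCode τ b t m k f A) 1 τ b t := by
  obtain ⟨p, hp, hmin⟩ := hf
  refine ⟨⟨Streaming.spreadCode_losslessDelay (by omega) hpad,
    Streaming.spreadCode_worstCaseDelay hb hτ hkm hpad hp.1 hA⟩, fun C hC hC' => ?_⟩
  obtain ⟨g, q, hgq, hsum⟩ := Streaming.exists_ipFeasible_of_code C hτ hC hC'
    (hpad t le_rfl (by omega))
  have h1 := hmin g q hgq
  have h2 := Streaming.messageCount_parity_le hb hτ hpad hp (t + 1)
  have h3 := Streaming.sum_spreadCode_size (A := A) hb hτ hpad hp.1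
  simp only [Streaming.messageCount] at h2 h3
  have h4 : ∑ i ∈ Finset.range (t + 1), (Streaming.spreadCode τ b t m k f A).size i
      ≤ ∑ i ∈ Finset.range (t + 1), C.size i := by omega
  unfold Streaming.rate
  -- Without message symbols both rates are 0; otherwise the Spread Code has positive length, so the
  -- division is monotone.
  rcases Nat.eq_zero_or_pos (∑ i ∈ Finset.range (t + 1), k i) with h0 | h0
  · have h5 : ∑ i ∈ Finset.range (t + 1), (k i : ℝ) = 0 := by exact_mod_cast h0
    simp [h5]
  · have h6 : 0 < ∑ i ∈ Finset.range (t + 1), (Streaming.spreadCode τ b t m k f A).size i := by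
      omega
    refine div_le_div_of_nonneg_left (by positivity) (by exact_mod_cast h6)
      (by exact_mod_cast h4)
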